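/- A polygon is a closed polygonal curve $P=\bigcup_i \overline{v_iv_{i+1}}\subset\mathbb R^2$ (indices cyclic) with finitely many, at least three, pairwise distinct vertices $v_1,\dots,v_n$, such that distinct open edges $v_iv_{i+1}$ are disjoint, no open edge contains a vertex, and no three consecutive vertices are collinear; it need not be convex. Its interior $\mathrm{int}(P)$ is the bounded connected component of $\mathbb R^2\setminus P$. For $y$ on an open edge of $P$, let $T_yP\subset\mathbb R^2$ be the line through $0$ parallel to that edge; these lines are the tangent directions of $P$ (opposite vectors give the same direction). Let $(P_-,P_+)$ be a pair of polygons with vertex sets $V_-,V_+$. The symplectic billiard map is $\phi(x,y)=(y,z)$, defined on the set $\mathcal P_{\max}$ of those $(x,y)\in(P_-\times P_+)\sqcup(P_+\times P_-)$, say $x\in P_\pm$ and $y\in P_\mp$, for which $y\notin V_\mp$ and there is exactly one point $z\in P_\pm$ with $z\neq x$, $z-x\in T_yP_\mp$ and open segment $xz\subset\mathrm{int}(P_\pm)$. Let $N_0=(P_-\times V_+)\sqcup(P_+\times V_-)$, $N_{i+1}=\phi^{-1}(N_i)$ for $i\ge 0$, $\sigma(x,y)=(y,x)$, and $N=\bigcup_{i\ge0}N_i\cup\sigma\big(\bigcup_{i\ge0}N_i\big)$.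 The phase space is $\mathcal P=\mathcal P_{\max}\setminus N$. A symplectic billiard orbit is a bi-infinite sequence $(p_k)_{k\in\mathbb Z}$ in $\mathcal P$ with $p_{k+1}=\phi(p_k)$ for all $k\in\mathbb Z$. Suppose that $V_-,V_+\subset\mathbb Z^2$ and that $P_-$ and $P_+$ together have at most three distinct tangent directions. Then through every point of $\mathcal P$ there is exactly one symplectic billiard orbit $(p_k)_{k\in\mathbb Z}$ with $p_0$ equal to that point, every symplectic billiard orbit is periodic, and the periods are uniformly bounded: there is $B\in\mathbb N$ (depending only on the pair $(P_-,P_+)$) such that for every orbit $(p_k)_{k\in\mathbb Z}$ there is an integer $1\le n\le B$ with $p_{k+n}=p_k$ for all $k\in\mathbb Z$. -/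

import Mathlib

open Set

namespace SymplecticBilliard

/-- The plane. Only its linear structure, topology and bounded sets are used below, so the choice
of norm is irrelevant. -/
abbrev Plane : Type := ℝ × ℝ

/-- An embedded polygon with `m + 3` cyclically ordered vertices: the vertices are pairwise
distinct, distinct open edges are disjoint, no open edge contains a vertex, and no three consecutive
vertices are collinear (`HasNondegenerateVertices`). Here `finRotate _ i` is the cyclic successor
of `i`. -/
structure EmbeddedPolygon where
  m : ℕ
  poly : Polygon Plane (m + 3)
  vertices_injective : Function.Injective poly.vertices
  edges_disjoint : ∀ i j : Fin (m + 3), i ≠ j →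
    Disjoint (openSegment ℝ (poly i) (poly (finRotate _ i)))
      (openSegment ℝ (poly j) (poly (finRotate _ j)))
  vertex_notMem_edge : ∀ i j : Fin (m + 3),
    poly i ∉ openSegment ℝ (poly j) (poly (finRotate _ j))
  nondegenerate : poly.HasNondegenerateVertices ℝ

namespace EmbeddedPolygon

variable (Q : EmbeddedPolygon)

/-- The closed polygonal curve (the union of the closed edges). -/
def curve : Set Plane := Q.poly.boundary ℝ

/-- The set of vertices. -/
def vertexSet : Set Plane := range Q.poly.vertices

/-- The open edge from vertex `i` to the next one. -/
def openEdge (i : Fin (Q.m + 3)) : Set Plane :=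
  openSegment ℝ (Q.poly i) (Q.poly (finRotate _ i))

/-- The direction of edge `i`, as a (non-oriented) line through the origin. -/
def edgeDirection (i : Fin (Q.m + 3)) : Submodule ℝ Plane :=
  Submodule.span ℝ {Q.poly (finRotate _ i) - Q.poly i}

/-- The set of tangent directions of the polygon. -/
def directions : Set (Submodule ℝ Plane) := range Q.edgeDirection

/-- The tangent line at `y`: the direction of the open edge containing `y`. Open edges are pairwise
disjoint, so this is a line through the origin if `y` lies on an open edge, and empty otherwise. -/
def tangent (y : Plane) : Set Plane := {d | ∃ i, y ∈ Q.openEdge i ∧ d ∈ Q.edgeDirection i}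

/-- The interior: the bounded connected component of the complement of the curve, i.e. the points
off the curve whose connected component in the complement is bounded. -/
def inside : Set Plane :=
  {p | p ∈ Q.curveᶜ ∧ Bornology.IsBounded (connectedComponentIn Q.curveᶜ p)}

end EmbeddedPolygon

/-- A point of the disjoint union of `P₋ × P₊` and `P₊ × P₋`. For a pair of tables
`P : Bool → EmbeddedPolygon`, with `P₋ = P false` and `P₊ = P true`, the point `fst` is meant to lie
on the table `P sign` and `snd` on the other table `P (!sign)`. -/
@[ext]
structure PhasePoint where
  sign : Bool
  fst : Plane
  snd : Plane

/-- The swap map. -/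
def PhasePoint.swap (p : PhasePoint) : PhasePoint := ⟨!p.sign, p.snd, p.fst⟩

variable (P : Bool → EmbeddedPolygon)

/-- The disjoint union of `P₋ × P₊` and `P₊ × P₋`. -/
def tablePairs : Set PhasePoint :=
  {p | p.fst ∈ (P p.sign).curve ∧ p.snd ∈ (P (!p.sign)).curve}

/-- For `p = (x, y)`, the point `z` lies on the table of `x` and on the line through `x` parallel to
the tangent at `y`, differs from `x`, and the open segment `xz` lies in the interior of the table. -/
def IsReflection (p : PhasePoint) (z : Plane) : Prop :=
  z ∈ (P p.sign).curve ∧ z - p.fst ∈ (P (!p.sign)).tangent p.snd ∧ z ≠ p.fst ∧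
    openSegment ℝ p.fst z ⊆ (P p.sign).inside

/-- The maximal phase space, on which the billiard map is defined for one step. -/
def maxPhaseSpace : Set PhasePoint :=
  {p | p ∈ tablePairs P ∧ p.snd ∉ (P (!p.sign)).vertexSet ∧ ∃! z, IsReflection P p z}

/-- The symplectic billiard map `(x, y) ↦ (y, z)`, with `z` the unique reflection point. -/
noncomputable def billiardMap (p : maxPhaseSpace P) : PhasePoint :=
  ⟨!p.1.sign, p.1.snd, Classical.choose p.2.2.2.exists⟩

/-- The pairs whose billiard orbit reaches, after `i` steps, a pair whose second point
is a vertex. -/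
def discontinuityStep : ℕ → Set PhasePoint
  | 0 => {p | p ∈ tablePairs P ∧ p.snd ∈ (P (!p.sign)).vertexSet}
  | i + 1 => {p | ∃ h : p ∈ maxPhaseSpace P, billiardMap P ⟨p, h⟩ ∈ discontinuityStep i}

/-- The discontinuity set. -/
def discontinuitySet : Set PhasePoint :=
  (⋃ i, discontinuityStep P i) ∪ PhasePoint.swap '' (⋃ i, discontinuityStep P i)

/-- The phase space. -/
def phaseSpace : Set PhasePoint := maxPhaseSpace P \ discontinuitySet P

/-- A symplectic billiard orbit: a bi-infinite sequence in the phase space in which every term is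
mapped to the next one by the billiard map. -/
def IsOrbit (o : ℤ → PhasePoint) : Prop :=
  (∀ k, o k ∈ phaseSpace P) ∧
    ∀ k, ∃ h : o k ∈ maxPhaseSpace P, billiardMap P ⟨o k, h⟩ = o (k + 1)

end SymplecticBilliard

/-! Periodicity is arithmetic. Choose integer vectors `u 0`, `u 1`, `u 2`, pairwise independent and
with sum zero, such that every edge is parallel to one of them; the areas `cross (u k) x` are then
three coordinates of `x` with sum zero. On an edge parallel to `u m` coordinate `m` is an integer,
since it is constant there and the vertices are lattice points. A reflection from `x` to `z` along
`u k` preserves coordinate `k`, and `z` lies on an edge parallel to some `u m` with `m ≠ k`. Two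
coordinates of `z` are thus controlled, and the third is minus their sum. Hence the coordinates of a
whole orbit stay, modulo integers, in a set `{0, ±t, ±t'}` fixed by its initial point
(`step_mem_integerShifts`). The tables are bounded, so the orbit visits at most a number of points
that does not depend on `t` and `t'`. Two visits coincide, and invertibility turns this into a
period.

Invertibility comes from the swap, which conjugates the map to its inverse (`Step.reverse`). This
needs a unique chord from each point of an open edge in each transversal direction
(`existsUnique_chord`), hence a local form of the Jordan curve theorem (`exists_inner_side`).
Slightly displaced copies of the polygon show that there are at most two sides. The turning angle
jumps by 2π across an edge and vanishes outside, so one side is inside; a ray from an extremal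
vertex shows that the other is not. -/

namespace SymplecticBilliard

/-! ### Plane linear algebra with the area form. -/

/-- The standard area form on the plane. -/
def cross (a b : Plane) : ℝ := a.1 * b.2 - a.2 * b.1

lemma cross_add_right (a b c : Plane) : cross a (b + c) = cross a b + cross a c := by
  simp only [cross, Prod.fst_add, Prod.snd_add]; ring

lemma cross_sub_right (a b c : Plane) : cross a (b - c) = cross a b - cross a c := by
  simp only [cross, Prod.fst_sub, Prod.snd_sub]; ring

lemma cross_smul_right (a b : Plane) (r : ℝ) : cross a (r • b) = r * cross a b := by
  simp only [cross, Prod.smul_fst, Prod.smul_snd, smul_eq_mul]; ring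

lemma cross_self (a : Plane) : cross a a = 0 := by
  simp only [cross]; ring

lemma cross_swap (a b : Plane) : cross b a = -cross a b := by
  simp only [cross]; ring

lemma continuous_cross (a : Plane) : Continuous (cross a) := by
  unfold cross; fun_prop

lemma exists_eq_smul_of_cross_eq_zero {a b : Plane} (ha : a ≠ 0) (h : cross a b = 0) :
    ∃ r : ℝ, b = r • a := by
  obtain ⟨a1, a2⟩ := a
  obtain ⟨b1, b2⟩ := b
  simp only [cross] at h
  by_cases h1 : a1 = 0
  · have h2 : a2 ≠ 0 := fun h2 => ha (by simp [h1, h2])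
    have h3 : b1 = 0 := by
      have : a2 * b1 = 0 := by rw [h1] at h; linarith
      exact (mul_eq_zero.mp this).resolve_left h2
    refine ⟨b2 / a2, Prod.ext ?_ ?_⟩
    · simp [h1, h3]
    · simp [h2]
  · refine ⟨b1 / a1, Prod.ext ?_ ?_⟩
    · simp [h1]
    · simp only [Prod.smul_mk, smul_eq_mul]; field_simp; linarith

lemma cross_eq_zero_of_cross_eq_zero {a b c : Plane} (ha : a ≠ 0) (hb : cross a b = 0)
    (hc : cross a c = 0) : cross b c = 0 := by
  obtain ⟨r, rfl⟩ := exists_eq_smul_of_cross_eq_zero ha hb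
  rw [cross_swap, cross_smul_right, cross_swap, hc]; simp

/-! ### Edges and vertices of an embedded polygon. -/

namespace EmbeddedPolygon

variable (Q : EmbeddedPolygon)

/-- The edge vector from vertex `i` to the next one. -/
def edgeVec (i : Fin (Q.m + 3)) : Plane := Q.poly (i + 1) - Q.poly i

/-- The closed edge from vertex `i` to the next one. -/
def closedEdge (i : Fin (Q.m + 3)) : Set Plane := segment ℝ (Q.poly i) (Q.poly (i + 1))

lemma openEdge_eq (i : Fin (Q.m + 3)) :
    Q.openEdge i = openSegment ℝ (Q.poly i) (Q.poly (i + 1)) := by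
  rw [openEdge, finRotate_apply]

lemma edgeDirection_eq (i : Fin (Q.m + 3)) :
    Q.edgeDirection i = Submodule.span ℝ {Q.edgeVec i} := by
  rw [edgeDirection, finRotate_apply, edgeVec]

lemma curve_eq : Q.curve = ⋃ i, Q.closedEdge i := by
  unfold curve Polygon.boundary Polygon.edgeSet closedEdge
  simp_rw [affineSegment_eq_segment, finRotate_apply]

lemma poly_succ (i : Fin (Q.m + 3)) : Q.poly (i + 1) = Q.poly i + Q.edgeVec i := by
  rw [edgeVec]; abel

lemma mem_openEdge {i : Fin (Q.m + 3)} {y : Plane} :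
    y ∈ Q.openEdge i ↔ ∃ s : ℝ, 0 < s ∧ s < 1 ∧ y = Q.poly i + s • Q.edgeVec i := by
  rw [openEdge_eq, openSegment_eq_image']
  simp only [mem_image, mem_Ioo, edgeVec]
  constructor
  · rintro ⟨s, ⟨h0, h1⟩, rfl⟩; exact ⟨s, h0, h1, rfl⟩
  · rintro ⟨s, h0, h1, rfl⟩; exact ⟨s, ⟨h0, h1⟩, rfl⟩

lemma mem_closedEdge {i : Fin (Q.m + 3)} {y : Plane} :
    y ∈ Q.closedEdge i ↔ ∃ s : ℝ, 0 ≤ s ∧ s ≤ 1 ∧ y = Q.poly i + s • Q.edgeVec i := by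
  rw [closedEdge, segment_eq_image']
  simp only [mem_image, mem_Icc, edgeVec]
  constructor
  · rintro ⟨s, ⟨h0, h1⟩, rfl⟩; exact ⟨s, h0, h1, rfl⟩
  · rintro ⟨s, h0, h1, rfl⟩; exact ⟨s, ⟨h0, h1⟩, rfl⟩

lemma openEdge_subset_closedEdge (i : Fin (Q.m + 3)) : Q.openEdge i ⊆ Q.closedEdge i := by
  rw [openEdge_eq]; exact openSegment_subset_segment ℝ _ _

lemma closedEdge_subset_curve (i : Fin (Q.m + 3)) : Q.closedEdge i ⊆ Q.curve := by
  rw [curve_eq]; exact subset_iUnion _ i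

lemma openEdge_subset_curve (i : Fin (Q.m + 3)) : Q.openEdge i ⊆ Q.curve :=
  (Q.openEdge_subset_closedEdge i).trans (Q.closedEdge_subset_curve i)

lemma mem_closedEdge_iff {i : Fin (Q.m + 3)} {y : Plane} :
    y ∈ Q.closedEdge i ↔ y = Q.poly i ∨ y = Q.poly (i + 1) ∨ y ∈ Q.openEdge i := by
  rw [closedEdge, openEdge_eq, ← insert_endpoints_openSegment]
  simp only [mem_insert_iff]

lemma isCompact_closedEdge (i : Fin (Q.m + 3)) : IsCompact (Q.closedEdge i) := by
  rw [closedEdge, segment_eq_image']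
  exact isCompact_Icc.image (by fun_prop)

lemma isCompact_curve : IsCompact Q.curve := by
  rw [curve_eq]; exact isCompact_iUnion Q.isCompact_closedEdge

lemma poly_mem_curve (i : Fin (Q.m + 3)) : Q.poly i ∈ Q.curve :=
  Q.closedEdge_subset_curve i (left_mem_segment ℝ _ _)

lemma exists_mem_openEdge {y : Plane} (hy : y ∈ Q.curve) (hv : y ∉ Q.vertexSet) :
    ∃ i, y ∈ Q.openEdge i := by
  rw [curve_eq, mem_iUnion] at hy
  obtain ⟨i, hi⟩ := hy
  rcases (Q.mem_closedEdge_iff).mp hi with h | h | h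
  · exact absurd ⟨_, h.symm⟩ hv
  · exact absurd ⟨_, h.symm⟩ hv
  · exact ⟨i, h⟩

lemma poly_notMem_openEdge (i j : Fin (Q.m + 3)) : Q.poly i ∉ Q.openEdge j :=
  Q.vertex_notMem_edge i j

lemma notMem_vertexSet_of_mem_openEdge {y : Plane} {i : Fin (Q.m + 3)} (hy : y ∈ Q.openEdge i) :
    y ∉ Q.vertexSet := by
  rintro ⟨j, rfl⟩; exact Q.poly_notMem_openEdge j i hy

lemma openEdge_index_unique {y : Plane} {i j : Fin (Q.m + 3)} (hi : y ∈ Q.openEdge i)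
    (hj : y ∈ Q.openEdge j) : i = j := by
  by_contra h
  exact Set.disjoint_left.mp (Q.edges_disjoint i j h) hi hj

lemma notMem_closedEdge_of_mem_openEdge {y : Plane} {i j : Fin (Q.m + 3)} (hi : y ∈ Q.openEdge i)
    (h : j ≠ i) : y ∉ Q.closedEdge j := by
  rw [mem_closedEdge_iff]
  rintro (rfl | rfl | hj)
  · exact Q.poly_notMem_openEdge _ _ hi
  · exact Q.poly_notMem_openEdge _ _ hi
  · exact h (Q.openEdge_index_unique hj hi)

lemma disjoint_closedEdge {i j : Fin (Q.m + 3)} (h : i ≠ j) (h1 : i + 1 ≠ j) (h2 : j + 1 ≠ i) :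
    Disjoint (Q.closedEdge i) (Q.closedEdge j) := by
  rw [Set.disjoint_left]
  intro y hi hj
  rcases (Q.mem_closedEdge_iff).mp hi with rfl | rfl | hi'
  · rcases (Q.mem_closedEdge_iff).mp hj with e | e | e
    · exact h (Q.vertices_injective e)
    · exact h2 (Q.vertices_injective e).symm
    · exact Q.poly_notMem_openEdge _ _ e
  · rcases (Q.mem_closedEdge_iff).mp hj with e | e | e
    · exact h1 (Q.vertices_injective e)
    · exact h (add_right_cancel (Q.vertices_injective e))
    · exact Q.poly_notMem_openEdge _ _ e
  · exact Q.notMem_closedEdge_of_mem_openEdge hi' h.symm hj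

lemma add_one_ne (i : Fin (Q.m + 3)) : i + 1 ≠ i := by
  intro h
  simp at h

lemma edgeVec_ne_zero (i : Fin (Q.m + 3)) : Q.edgeVec i ≠ 0 := by
  intro h
  exact Q.add_one_ne i (Q.vertices_injective (sub_eq_zero.mp h))

lemma cross_edgeVec_succ (i : Fin (Q.m + 3)) :
    cross (Q.edgeVec i) (Q.edgeVec (i + 1)) ≠ 0 := by
  intro h
  obtain ⟨r, hr⟩ := exists_eq_smul_of_cross_eq_zero (Q.edgeVec_ne_zero i) h
  have hnd := Q.nondegenerate i
  rw [affineIndependent_iff_not_collinear_set] at hnd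
  refine hnd ((collinear_iff_of_mem (p₀ := Q.poly i) (by simp)).mpr ⟨Q.edgeVec i, ?_⟩)
  have h2 : Q.poly (i + 2) = Q.poly i + Q.edgeVec i + r • Q.edgeVec i := by
    rw [← hr, ← poly_succ, ← poly_succ, add_assoc]
    congr 2
  simp only [mem_insert_iff, mem_singleton_iff, vadd_eq_add]
  rintro p (rfl | rfl | rfl)
  · exact ⟨0, by simp⟩
  · exact ⟨1, by rw [poly_succ]; module⟩
  · exact ⟨1 + r, by rw [h2]; module⟩

end EmbeddedPolygon

/-! ### Displaced polygons and the two sides of the curve. -/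

namespace EmbeddedPolygon

variable (Q : EmbeddedPolygon)

/-- A vector at vertex `i` having area `1` with both edges meeting there, so that moving each vertex
by `δ` times this vector displaces every edge parallel to itself. -/
noncomputable def corner (i : Fin (Q.m + 3)) : Plane :=
  (cross (Q.edgeVec (i - 1)) (Q.edgeVec i))⁻¹ • (Q.edgeVec i - Q.edgeVec (i - 1))

lemma cross_edgeVec_corner (i : Fin (Q.m + 3)) : cross (Q.edgeVec i) (Q.corner i) = 1 := by
  have h := Q.cross_edgeVec_succ (i - 1)
  rw [sub_add_cancel] at h
  rw [corner, cross_smul_right, cross_sub_right, cross_self,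
    cross_swap (Q.edgeVec (i - 1)) (Q.edgeVec i), zero_sub, neg_neg,
    inv_mul_cancel₀ h]

lemma cross_edgeVec_corner_succ (i : Fin (Q.m + 3)) :
    cross (Q.edgeVec i) (Q.corner (i + 1)) = 1 := by
  have h := Q.cross_edgeVec_succ i
  rw [corner, add_sub_cancel_right, cross_smul_right, cross_sub_right, cross_self, sub_zero,
    inv_mul_cancel₀ h]

/-- The point with parameter `s` on the edge `i`, displaced by `δ`. -/
noncomputable def offset (i : Fin (Q.m + 3)) (δ s : ℝ) : Plane :=
  Q.poly i + s • Q.edgeVec i + δ • ((1 - s) • Q.corner i + s • Q.corner (i + 1))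

lemma continuous_offset (i : Fin (Q.m + 3)) :
    Continuous fun x : ℝ × ℝ => Q.offset i x.1 x.2 := by
  unfold offset; fun_prop

lemma offset_zero_right (i : Fin (Q.m + 3)) (δ : ℝ) :
    Q.offset i δ 0 = Q.poly i + δ • Q.corner i := by
  simp [offset]

lemma offset_one_right (i : Fin (Q.m + 3)) (δ : ℝ) :
    Q.offset i δ 1 = Q.offset (i + 1) δ 0 := by
  rw [offset_zero_right, poly_succ]; simp [offset]

lemma offset_zero_left (i : Fin (Q.m + 3)) (s : ℝ) :
    Q.offset i 0 s = Q.poly i + s • Q.edgeVec i := by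
  simp [offset]

lemma cross_offset (i : Fin (Q.m + 3)) (δ s : ℝ) :
    cross (Q.edgeVec i) (Q.offset i δ s - Q.poly i) = δ := by
  have : Q.offset i δ s - Q.poly i =
      s • Q.edgeVec i + δ • ((1 - s) • Q.corner i + s • Q.corner (i + 1)) := by
    rw [offset]; abel
  rw [this]
  simp only [cross_add_right, cross_smul_right, cross_self, cross_edgeVec_corner,
    cross_edgeVec_corner_succ]
  ring

lemma cross_of_mem_closedEdge {i : Fin (Q.m + 3)} {y : Plane} (hy : y ∈ Q.closedEdge i) :
    cross (Q.edgeVec i) (y - Q.poly i) = 0 := by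
  obtain ⟨s, -, -, rfl⟩ := Q.mem_closedEdge.mp hy
  rw [add_sub_cancel_left, cross_smul_right, cross_self, mul_zero]

-- Says that `D + δ * K` keeps the sign of `D` for small `δ`; it is multiplied by `D` to treat both
-- signs at once.
open Filter Topology in
lemma eventually_sq_add_pos {D : ℝ} (hD : D ≠ 0) (K : ℝ) :
    ∀ᶠ δ in 𝓝[≠] (0 : ℝ), 0 < D ^ 2 + δ * K * D := by
  have h : Tendsto (fun δ : ℝ => D ^ 2 + δ * K * D) (𝓝 0) (𝓝 (D ^ 2 + 0 * K * D)) :=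
    Continuous.tendsto (by fun_prop) 0
  refine (h.eventually (lt_mem_nhds ?_)).filter_mono nhdsWithin_le_nhds
  have := sq_pos_of_ne_zero hD
  linarith

lemma convex_combination_pos {s a b : ℝ} (h0 : 0 ≤ s) (h1 : s ≤ 1) (ha : 0 < a) (hb : 0 < b) :
    0 < s * a + (1 - s) * b := by
  rcases h0.eq_or_lt with rfl | h
  · simpa using hb
  · have := mul_pos h ha
    have := mul_nonneg (sub_nonneg.mpr h1) hb.le
    linarith

-- An intersection at parameter `r` of the next edge forces `δ = r * D`, so `δ` has the sign of `D`.
-- The area of the displaced point with the next edge is a convex combination of `δ` and `D + δ *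
-- K`, both of that sign, and cannot vanish.
open Filter Topology in
lemma eventually_offset_notMem_succ (i : Fin (Q.m + 3)) :
    ∀ᶠ δ in 𝓝[≠] (0 : ℝ), ∀ s ∈ Icc (0 : ℝ) 1, Q.offset i δ s ∉ Q.closedEdge (i + 1) := by
  have hD := Q.cross_edgeVec_succ i
  set D := cross (Q.edgeVec i) (Q.edgeVec (i + 1)) with hDdef
  set K := cross (Q.edgeVec (i + 1)) (Q.corner i) with hK
  filter_upwards [eventually_sq_add_pos hD K, self_mem_nhdsWithin] with δ hδ hne s hs hmem
  obtain ⟨r, hr0, hr1, hr⟩ := Q.mem_closedEdge.mp hmem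
  have hA : δ = r * D := by
    have h := Q.cross_offset i δ s
    rw [hr, poly_succ, add_assoc, add_sub_cancel_left, cross_add_right, cross_smul_right,
      cross_self] at h
    linarith
  have hB : s * δ + (1 - s) * (D + δ * K) = 0 := by
    have h := Q.cross_of_mem_closedEdge hmem
    have h2 : Q.offset i δ s - Q.poly (i + 1) =
        (-(1 - s)) • Q.edgeVec i + δ • ((1 - s) • Q.corner i + s • Q.corner (i + 1)) := by
      rw [offset, poly_succ]; module
    rw [h2] at h
    simp only [cross_add_right, cross_smul_right, cross_edgeVec_corner] at h
    rw [cross_swap, ← hDdef, ← hK] at h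
    linarith
  have hδD : 0 < δ * D := by
    have h1 : 0 ≤ δ * D := by rw [hA, mul_assoc]; exact mul_nonneg hr0 (mul_self_nonneg D)
    exact lt_of_le_of_ne h1 (mul_ne_zero hne hD).symm
  have := convex_combination_pos hs.1 hs.2 hδD hδ
  have h0 : (s * δ + (1 - s) * (D + δ * K)) * D = 0 := by rw [hB, zero_mul]
  linarith

open Filter Topology in
lemma eventually_offset_notMem_pred (j : Fin (Q.m + 3)) :
    ∀ᶠ δ in 𝓝[≠] (0 : ℝ), ∀ s ∈ Icc (0 : ℝ) 1, Q.offset (j + 1) δ s ∉ Q.closedEdge j := by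
  have hD := Q.cross_edgeVec_succ j
  set D := cross (Q.edgeVec j) (Q.edgeVec (j + 1)) with hDdef
  set K := cross (Q.edgeVec j) (Q.corner (j + 1 + 1)) with hK
  filter_upwards [eventually_sq_add_pos hD K, self_mem_nhdsWithin] with δ hδ hne s hs hmem
  obtain ⟨r, hr0, hr1, hr⟩ := Q.mem_closedEdge.mp hmem
  have hA : δ = (1 - r) * D := by
    have h := Q.cross_offset (j + 1) δ s
    have h2 : Q.poly j + r • Q.edgeVec j - (Q.poly j + Q.edgeVec j) = (-(1 - r)) • Q.edgeVec j := by
      module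
    rw [hr, poly_succ, h2, cross_smul_right, cross_swap, ← hDdef] at h
    linarith
  have hB : s * (D + δ * K) + (1 - s) * δ = 0 := by
    have h := Q.cross_of_mem_closedEdge hmem
    have h2 : Q.offset (j + 1) δ s - Q.poly j = Q.edgeVec j +
        s • Q.edgeVec (j + 1) + δ • ((1 - s) • Q.corner (j + 1) + s • Q.corner (j + 1 + 1)) := by
      rw [offset, poly_succ]; module
    rw [h2] at h
    simp only [cross_add_right, cross_smul_right, cross_edgeVec_corner_succ, cross_self] at h
    rw [← hDdef, ← hK] at h
    linarith
  have hδD : 0 < δ * D := by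
    have h1 : 0 ≤ δ * D := by
      rw [hA, mul_assoc]; exact mul_nonneg (by linarith) (mul_self_nonneg D)
    exact lt_of_le_of_ne h1 (mul_ne_zero hne hD).symm
  have := convex_combination_pos hs.1 hs.2 hδ hδD
  have h0 : (s * (D + δ * K) + (1 - s) * δ) * D = 0 := by rw [hB, zero_mul]
  linarith

open Filter Topology in
lemma eventually_offset_notMem_closedEdge (i j : Fin (Q.m + 3)) :
    ∀ᶠ δ in 𝓝[≠] (0 : ℝ), ∀ s ∈ Icc (0 : ℝ) 1, Q.offset i δ s ∉ Q.closedEdge j := by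
  by_cases h : i = j
  · subst h
    filter_upwards [self_mem_nhdsWithin] with δ hne s _ hmem
    have := Q.cross_of_mem_closedEdge hmem
    rw [cross_offset] at this
    exact hne this
  by_cases h1 : i + 1 = j
  · subst h1; exact Q.eventually_offset_notMem_succ i
  by_cases h2 : j + 1 = i
  · subst h2; exact Q.eventually_offset_notMem_pred j
  -- Edges without a common vertex are disjoint already at `δ = 0`, and compactness of `[0, 1]`
  -- extends this to nearby `δ`.
  refine Filter.Eventually.filter_mono nhdsWithin_le_nhds ?_
  refine isCompact_Icc.eventually_forall_of_forall_eventually fun s hs => ?_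
  refine (Q.continuous_offset i).continuousAt.eventually
    ((Q.isCompact_closedEdge j).isClosed.isOpen_compl.mem_nhds ?_)
  have hmem : Q.offset i 0 s ∈ Q.closedEdge i :=
    Q.mem_closedEdge.mpr ⟨s, hs.1, hs.2, Q.offset_zero_left i s⟩
  exact Set.disjoint_left.mp (Q.disjoint_closedEdge h h1 h2) hmem

open Filter Topology in
lemma exists_offset_notMem_curve :
    ∃ ε > 0, ∀ δ : ℝ, δ ≠ 0 → |δ| < ε → ∀ i, ∀ s ∈ Icc (0 : ℝ) 1, Q.offset i δ s ∉ Q.curve := by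
  have h : ∀ᶠ δ in 𝓝[≠] (0 : ℝ), ∀ i j, ∀ s ∈ Icc (0 : ℝ) 1, Q.offset i δ s ∉ Q.closedEdge j :=
    eventually_all.mpr fun i => eventually_all.mpr fun j =>
      Q.eventually_offset_notMem_closedEdge i j
  rw [eventually_nhdsWithin_iff, Metric.eventually_nhds_iff] at h
  obtain ⟨ε, hε, h⟩ := h
  refine ⟨ε, hε, fun δ hne hδ i s hs hmem => ?_⟩
  rw [curve_eq, mem_iUnion] at hmem
  obtain ⟨j, hj⟩ := hmem
  exact h (by simpa [Real.dist_eq] using hδ) hne i j s hs hj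

/-- Two points lie in a common connected subset of the complement of the curve. -/
def Linked (p q : Plane) : Prop := ∃ S ⊆ Q.curveᶜ, IsPreconnected S ∧ p ∈ S ∧ q ∈ S

variable {Q}

lemma Linked.symm {p q : Plane} (h : Q.Linked p q) : Q.Linked q p := by
  obtain ⟨S, h1, h2, h3, h4⟩ := h
  exact ⟨S, h1, h2, h4, h3⟩

lemma Linked.trans {p q r : Plane} (h : Q.Linked p q) (h' : Q.Linked q r) : Q.Linked p r := by
  obtain ⟨S, h1, h2, h3, h4⟩ := h
  obtain ⟨S', h1', h2', h3', h4'⟩ := h'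
  exact ⟨S ∪ S', union_subset h1 h1', h2.union q h4 h3' h2', Or.inl h3, Or.inr h4'⟩

lemma Linked.mem_connectedComponentIn {p q : Plane} (h : Q.Linked p q) :
    q ∈ connectedComponentIn Q.curveᶜ p := by
  obtain ⟨S, h1, h2, h3, h4⟩ := h
  exact h2.subset_connectedComponentIn h3 h1 h4

lemma Linked.mem_inside_iff {p q : Plane} (h : Q.Linked p q) : p ∈ Q.inside ↔ q ∈ Q.inside := by
  have h1 := connectedComponentIn_eq h.mem_connectedComponentIn
  obtain ⟨S, hS, -, h3, h4⟩ := h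
  simp only [inside, mem_ofPred_eq, h1, hS h3, hS h4]

variable (Q)

lemma linked_offset {δ : ℝ} (h : ∀ i, ∀ s ∈ Icc (0 : ℝ) 1, Q.offset i δ s ∉ Q.curve)
    (i : Fin (Q.m + 3)) {s t : ℝ} (hs : s ∈ Icc (0 : ℝ) 1) (ht : t ∈ Icc (0 : ℝ) 1) :
    Q.Linked (Q.offset i δ s) (Q.offset i δ t) := by
  refine ⟨(fun s => Q.offset i δ s) '' Icc 0 1, ?_, ?_, mem_image_of_mem _ hs,
    mem_image_of_mem _ ht⟩
  · rintro _ ⟨u, hu, rfl⟩; exact h i u hu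
  · exact isPreconnected_Icc.image _
      ((Q.continuous_offset i).comp (by fun_prop : Continuous fun s => (δ, s))).continuousOn

lemma linked_offset_zero {δ : ℝ} (h : ∀ i, ∀ s ∈ Icc (0 : ℝ) 1, Q.offset i δ s ∉ Q.curve)
    (i : Fin (Q.m + 3)) : Q.Linked (Q.offset 0 δ 0) (Q.offset i δ 0) := by
  have h0 : (0 : ℝ) ∈ Icc (0 : ℝ) 1 := by simp
  have h1 : (1 : ℝ) ∈ Icc (0 : ℝ) 1 := by simp
  induction i using Fin.induction with
  | zero => exact Q.linked_offset h 0 h0 h0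
  | succ i ih =>
    have := Q.linked_offset h i.castSucc h0 h1
    rw [offset_one_right, Fin.coeSucc_eq_succ] at this
    exact ih.trans this

/-- The two sides of the curve: all points near open edges and on the same side are linked. -/
theorem exists_sides : ∃ σ : ℝ → Plane,
    (∀ i, ∀ q ∈ Q.openEdge i, ∃ r > 0, ∀ p ∈ Metric.ball q r, ∀ η : ℝ, (η = 1 ∨ η = -1) →
      0 < η * cross (Q.edgeVec i) (p - Q.poly i) → Q.Linked (σ η) p) ∧
    ∀ η : ℝ, (η = 1 ∨ η = -1) → ∀ i, ∃ δ > 0,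
      Q.Linked (σ η) (Q.poly i + (η * δ) • Q.corner i) := by
  obtain ⟨ε, hε, h⟩ := Q.exists_offset_notMem_curve
  -- All displaced curves with the same sign `η` are linked: vary the displacement at vertex 0, then
  -- travel along the displaced curve.
  have key : ∀ η : ℝ, (η = 1 ∨ η = -1) → ∀ δ : ℝ, 0 < δ → δ < ε → ∀ i, ∀ s ∈ Icc (0 : ℝ) 1,
      Q.Linked (Q.offset 0 (η * (ε / 2)) 0) (Q.offset i (η * δ) s) := by
    intro η hη δ hδ0 hδ i s hs
    have hav : ∀ u, 0 < u → u < ε → ∀ i, ∀ s ∈ Icc (0 : ℝ) 1, Q.offset i (η * u) s ∉ Q.curve := by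
      intro u hu0 hu
      refine h _ ?_ ?_
      · rcases hη with rfl | rfl <;> simp [hu0.ne']
      · rcases hη with rfl | rfl <;> simpa [abs_of_pos hu0] using hu
    have h0 : (0 : ℝ) ∈ Icc (0 : ℝ) 1 := by simp
    have h1 : Q.Linked (Q.offset 0 (η * (ε / 2)) 0) (Q.offset 0 (η * δ) 0) := by
      refine ⟨(fun u => Q.offset 0 (η * u) 0) '' Ioo 0 ε, ?_, ?_,
        mem_image_of_mem (fun u => Q.offset 0 (η * u) 0) ⟨by linarith, by linarith⟩,
        mem_image_of_mem (fun u => Q.offset 0 (η * u) 0) ⟨hδ0, hδ⟩⟩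
      · rintro _ ⟨u, hu, rfl⟩; exact hav u hu.1 hu.2 0 0 h0
      · exact isPreconnected_Ioo.image _
          ((Q.continuous_offset 0).comp
            (by fun_prop : Continuous fun u : ℝ => (η * u, (0 : ℝ)))).continuousOn
    exact h1.trans ((Q.linked_offset_zero (hav δ hδ0 hδ) i).trans
      (Q.linked_offset (hav δ hδ0 hδ) i h0 hs))
  refine ⟨fun η => Q.offset 0 (η * (ε / 2)) 0, fun i q hq => ?_, fun η hη i =>
    ⟨ε / 2, by linarith, ?_⟩⟩
  · obtain ⟨r, hr, hball⟩ : ∃ r > 0, ∀ p ∈ Metric.ball q r, ∀ j ≠ i, p ∉ Q.closedEdge j := by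
      have hev : ∀ᶠ p in nhds q, ∀ j, j ≠ i → p ∉ Q.closedEdge j := by
        refine Filter.eventually_all.mpr fun j => ?_
        by_cases hj : j = i
        · simp [hj]
        · filter_upwards [(Q.isCompact_closedEdge j).isClosed.isOpen_compl.mem_nhds
            (Q.notMem_closedEdge_of_mem_openEdge hq hj)] with p hp _
          exact hp
      obtain ⟨r, hr, hb⟩ := Metric.eventually_nhds_iff_ball.mp hev
      exact ⟨r, hr, hb⟩
    refine ⟨r, hr, fun p hp η hη hpos => ?_⟩
    obtain ⟨s, hs0, hs1, hs⟩ := Q.mem_openEdge.mp hq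
    have htend : Filter.Tendsto (fun δ => Q.offset i (η * δ) s) (nhds 0) (nhds q) := by
      have hc : Continuous fun δ : ℝ => Q.offset i (η * δ) s :=
        (Q.continuous_offset i).comp (by fun_prop : Continuous fun u : ℝ => (η * u, s))
      have := hc.tendsto 0
      rwa [mul_zero, offset_zero_left, ← hs] at this
    obtain ⟨ρ, hρ, hρb⟩ := Metric.eventually_nhds_iff.mp
      (htend.eventually (Metric.ball_mem_nhds q hr))
    set δ := min ρ ε / 2 with hδ
    have hmin : 0 < min ρ ε := lt_min hρ hε
    have hδ0 : 0 < δ := by linarith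
    have hδρ : δ < ρ := by have := min_le_left ρ ε; linarith
    have hδε : δ < ε := by have := min_le_right ρ ε; linarith
    -- The half disc on the chosen side of edge `i` is convex and off the curve; it joins `p` to a
    -- point of a displaced curve.
    refine (key η hη δ hδ0 hδε i s ⟨hs0.le, hs1.le⟩).trans
      ⟨Metric.ball q r ∩ {x | 0 < η * cross (Q.edgeVec i) (x - Q.poly i)}, ?_, ?_, ⟨?_, ?_⟩, hp,
        hpos⟩
    · rintro x ⟨hx, hx'⟩ hxc
      rw [curve_eq, mem_iUnion] at hxc
      obtain ⟨j, hj⟩ := hxc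
      by_cases hji : j = i
      · subst hji
        rw [mem_ofPred_eq, Q.cross_of_mem_closedEdge hj] at hx'
        simp at hx'
      · exact hball x hx j hji hj
    · refine ((convex_ball q r).inter ?_).isPreconnected
      intro x hx y hy a b ha hb hab
      simp only [mem_ofPred_eq] at hx hy ⊢
      have : a • x + b • y - Q.poly i = a • (x - Q.poly i) + b • (y - Q.poly i) := by
        have hb' : b = 1 - a := by linarith
        rw [hb']; module
      rw [this, cross_add_right, cross_smul_right, cross_smul_right]
      have h2 := convex_combination_pos (s := a) ha (by linarith) hx hy
      have hb' : 1 - a = b := by linarith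
      rw [hb'] at h2
      linarith
    · exact hρb (by simpa [Real.dist_eq, abs_of_pos hδ0] using hδρ)
    · rw [mem_ofPred_eq, cross_offset]
      rcases hη with rfl | rfl <;> simpa using hδ0
  · have := key η hη (ε / 2) (by linarith) (by linarith) i 0 (by simp)
    rwa [Q.offset_zero_right i] at this

end EmbeddedPolygon

/-! ### The turning angle of the curve and its inner side. -/

/-- The identification of the plane with the complex numbers. -/
def toComplex (p : Plane) : ℂ := ⟨p.1, p.2⟩

lemma continuous_toComplex : Continuous toComplex :=
  Complex.equivRealProdCLM.symm.continuous

lemma toComplex_eq_zero {p : Plane} : toComplex p = 0 ↔ p = 0 := by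
  simp [toComplex, Complex.ext_iff, Prod.ext_iff]

lemma toComplex_sub (p q : Plane) : toComplex (p - q) = toComplex p - toComplex q := by
  simp [toComplex, Complex.ext_iff]

lemma norm_le_norm_toComplex (p : Plane) : ‖p‖ ≤ ‖toComplex p‖ :=
  max_le (Complex.abs_re_le_norm (toComplex p)) (Complex.abs_im_le_norm (toComplex p))

/-- The ratio whose argument is the angle of the segment from `a` to `b` seen from `p`. -/
noncomputable def viewRatio (a b p : Plane) : ℂ := toComplex (b - p) / toComplex (a - p)

lemma mem_segment_of_viewRatio_nonpos {a b p : Plane} (hp : p ≠ a)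
    (hre : (viewRatio a b p).re ≤ 0) (him : (viewRatio a b p).im = 0) :
    p ∈ segment ℝ a b := by
  have ha : toComplex (a - p) ≠ 0 := by
    rw [Ne, toComplex_eq_zero, sub_eq_zero]; exact hp.symm
  set t := -(viewRatio a b p).re with ht
  have ht0 : 0 ≤ t := by linarith
  have hz : viewRatio a b p = ((-t : ℝ) : ℂ) := by
    apply Complex.ext <;> simp [ht, him]
  rw [viewRatio, div_eq_iff ha] at hz
  have h1 : b.1 - p.1 = -t * (a.1 - p.1) := by simpa [toComplex] using congrArg Complex.re hz
  have h2 : b.2 - p.2 = -t * (a.2 - p.2) := by simpa [toComplex] using congrArg Complex.im hz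
  have hpos : 0 < 1 + t := by linarith
  refine ⟨t / (1 + t), 1 / (1 + t), by positivity, by positivity, by field_simp; ring, ?_⟩
  apply Prod.ext
  · simp only [Prod.fst_add, Prod.smul_fst, smul_eq_mul]; field_simp; linarith
  · simp only [Prod.snd_add, Prod.smul_snd, smul_eq_mul]; field_simp; linarith

lemma viewRatio_mem_slitPlane {a b p : Plane} (hp : p ∉ segment ℝ a b) :
    viewRatio a b p ∈ Complex.slitPlane := by
  by_contra h
  rw [Complex.mem_slitPlane_iff, not_or, not_lt, not_not] at h
  exact hp (mem_segment_of_viewRatio_nonpos (fun e => hp (e ▸ left_mem_segment ℝ a b)) h.1 h.2)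

lemma continuousAt_viewRatio {a b p : Plane} (hp : p ≠ a) : ContinuousAt (viewRatio a b) p := by
  unfold viewRatio
  refine ContinuousAt.div ?_ ?_ ?_
  · exact (continuous_toComplex.comp (by fun_prop)).continuousAt
  · exact (continuous_toComplex.comp (by fun_prop)).continuousAt
  · rw [Ne, toComplex_eq_zero, sub_eq_zero]; exact hp.symm

lemma viewRatio_im (a b p : Plane) :
    (viewRatio a b p).im = cross (b - a) (p - a) / Complex.normSq (toComplex (a - p)) := by
  rw [viewRatio, Complex.div_im]
  simp only [toComplex, cross, Prod.fst_sub, Prod.snd_sub]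
  ring

-- The ratio equals `1 + (b - a) / (a - p)`.
open Filter Topology in
lemma tendsto_viewRatio_cobounded (a b : Plane) :
    Tendsto (viewRatio a b) (Bornology.cobounded Plane) (𝓝 1) := by
  have h1 : Tendsto (fun p => toComplex (a - p)) (Bornology.cobounded Plane)
      (Bornology.cobounded ℂ) := by
    rw [← tendsto_norm_atTop_iff_cobounded]
    refine tendsto_atTop_mono (f := fun p => ‖p‖ - ‖a‖) (fun p => ?_)
      (tendsto_atTop_add_const_right _ _ tendsto_norm_cobounded_atTop)
    refine le_trans ?_ (norm_le_norm_toComplex _)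
    rw [norm_sub_rev]
    exact norm_sub_norm_le p a
  have h2 : Tendsto (fun p => 1 + toComplex (b - a) * (toComplex (a - p))⁻¹)
      (Bornology.cobounded Plane) (𝓝 (1 + toComplex (b - a) * 0)) :=
    tendsto_const_nhds.add (tendsto_const_nhds.mul (tendsto_inv₀_cobounded.comp h1))
  rw [mul_zero, add_zero] at h2
  refine h2.congr' ?_
  have h3 : ∀ᶠ p in Bornology.cobounded Plane, p ≠ a :=
    Bornology.isBounded_def.mp (Bornology.isBounded_singleton (x := a))
  filter_upwards [h3] with p hp
  have ha : toComplex (a - p) ≠ 0 := by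
    rw [Ne, toComplex_eq_zero, sub_eq_zero]; exact hp.symm
  rw [viewRatio]
  field_simp
  simp only [toComplex_sub]
  ring

namespace EmbeddedPolygon

variable (Q : EmbeddedPolygon)

/-- The angle of edge `i` seen from `p`. -/
noncomputable def viewAngle (i : Fin (Q.m + 3)) (p : Plane) : ℝ :=
  (viewRatio (Q.poly i) (Q.poly (i + 1)) p).arg

/-- The total angle by which the curve turns around `p`. -/
noncomputable def totalAngle (p : Plane) : ℝ := ∑ i, Q.viewAngle i p

lemma continuousAt_viewAngle {i : Fin (Q.m + 3)} {p : Plane} (hp : p ∉ Q.closedEdge i) :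
    ContinuousAt (Q.viewAngle i) p :=
  (Complex.continuousAt_arg (viewRatio_mem_slitPlane hp)).comp
    (continuousAt_viewRatio fun e => hp (e ▸ left_mem_segment ℝ _ _))

lemma continuousOn_totalAngle : ContinuousOn Q.totalAngle Q.curveᶜ := by
  intro p hp
  refine ContinuousAt.continuousWithinAt ?_
  unfold totalAngle
  exact tendsto_finsetSum _ fun i _ =>
    Q.continuousAt_viewAngle fun h => hp (Q.closedEdge_subset_curve i h)

/-- Modulo 2π each view angle is a difference of arguments at consecutive vertices, and these cancel
cyclically. -/
lemma exists_totalAngle_eq {p : Plane} (hp : p ∉ Q.curve) :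
    ∃ k : ℤ, Q.totalAngle p = 2 * Real.pi * k := by
  have hne : ∀ i, toComplex (Q.poly i - p) ≠ 0 := by
    intro i
    rw [Ne, toComplex_eq_zero, sub_eq_zero]
    exact fun e => hp (e ▸ Q.poly_mem_curve i)
  have h : ((Q.totalAngle p : ℝ) : Real.Angle) = ((0 : ℝ) : Real.Angle) := by
    have h1 : ((Q.totalAngle p : ℝ) : Real.Angle) =
        ∑ i, ((Q.viewAngle i p : ℝ) : Real.Angle) :=
      map_sum Real.Angle.coeHom _ _
    rw [h1]
    simp_rw [viewAngle, viewRatio, Complex.arg_div_coe_angle (hne _) (hne _)]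
    rw [Finset.sum_sub_distrib, Real.Angle.coe_zero, sub_eq_zero]
    exact Equiv.sum_comp (Equiv.addRight (1 : Fin (Q.m + 3)))
      fun i => ((toComplex (Q.poly i - p)).arg : Real.Angle)
  obtain ⟨k, hk⟩ := Real.Angle.angle_eq_iff_two_pi_dvd_sub.mp h
  exact ⟨k, by linarith⟩

open Filter Topology in
lemma tendsto_totalAngle_cobounded :
    Tendsto Q.totalAngle (Bornology.cobounded Plane) (𝓝 0) := by
  have h : Tendsto Q.totalAngle (Bornology.cobounded Plane)
      (𝓝 (∑ _i : Fin (Q.m + 3), (0 : ℝ))) := by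
    unfold totalAngle
    refine tendsto_finsetSum _ fun i _ => ?_
    have := (Complex.continuousAt_arg Complex.one_mem_slitPlane).tendsto.comp
      (tendsto_viewRatio_cobounded (Q.poly i) (Q.poly (i + 1)))
    rwa [Complex.arg_one] at this
  simpa using h

/-- The curve does not turn around points outside. -/
lemma totalAngle_eq_zero {p : Plane} (hp : p ∉ Q.curve) (hin : p ∉ Q.inside) :
    Q.totalAngle p = 0 := by
  set C := connectedComponentIn Q.curveᶜ p with hC
  have hunb : ¬ Bornology.IsBounded C := fun h => hin ⟨hp, h⟩
  have hCs : C ⊆ Q.curveᶜ := connectedComponentIn_subset _ _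
  have hpC : p ∈ C := mem_connectedComponentIn hp
  have hfar : ∀ᶠ x in Bornology.cobounded Plane, |Q.totalAngle x| < Real.pi := by
    have := Q.tendsto_totalAngle_cobounded.abs
    rw [abs_zero] at this
    exact this.eventually (gt_mem_nhds Real.pi_pos)
  obtain ⟨x, hxC, hx⟩ : ∃ x ∈ C, |Q.totalAngle x| < Real.pi := by
    by_contra! h
    refine hunb ?_
    rw [Bornology.isBounded_def]
    filter_upwards [hfar] with x hx hxC
    exact absurd hx (not_lt.mpr (h x hxC))
  by_contra hne
  obtain ⟨k, hk⟩ := Q.exists_totalAngle_eq hp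
  have hk0 : k ≠ 0 := by rintro rfl; exact hne (by simpa using hk)
  have hge : Real.pi ≤ |Q.totalAngle p| := by
    rw [hk, abs_mul, abs_of_pos Real.two_pi_pos]
    have : (1 : ℝ) ≤ |(k : ℝ)| := by exact_mod_cast Int.one_le_abs hk0
    nlinarith [Real.pi_pos]
  -- The unbounded component would contain a point with absolute angle exactly π, which is not a
  -- multiple of 2π.
  obtain ⟨y, hyC, hy⟩ := isPreconnected_connectedComponentIn.intermediate_value hxC hpC
    (Q.continuousOn_totalAngle.mono hCs).abs ⟨hx.le, hge⟩
  obtain ⟨l, hl⟩ := Q.exists_totalAngle_eq (hCs hyC)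
  simp only [hl, abs_mul, abs_of_pos Real.two_pi_pos] at hy
  have h2 : (2 : ℝ) * |(l : ℝ)| = 1 := by
    have := Real.pi_pos
    have h3 : Real.pi * (2 * |(l : ℝ)| - 1) = 0 := by linarith
    rcases mul_eq_zero.mp h3 with h | h <;> linarith
  have h4 : 2 * |l| = 1 := by exact_mod_cast h2
  omega

-- On the open edge the ratio is a negative real, on the cut of `arg`; the side `η` is the sign of
-- its imaginary part nearby.
open Filter Topology in
lemma tendsto_viewAngle {i : Fin (Q.m + 3)} {q : Plane} (hq : q ∈ Q.openEdge i) {η : ℝ}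
    (hη : η = 1 ∨ η = -1) :
    Tendsto (fun t : ℝ => Q.viewAngle i (q + (η * t) • Q.corner i)) (𝓝[>] 0)
      (𝓝 (η * Real.pi)) := by
  have hqa : q ≠ Q.poly i := fun e => Q.poly_notMem_openEdge i i (e ▸ hq)
  have hcr : cross (Q.edgeVec i) (q - Q.poly i) = 0 :=
    Q.cross_of_mem_closedEdge (Q.openEdge_subset_closedEdge i hq)
  set z := viewRatio (Q.poly i) (Q.poly (i + 1)) q with hz
  have him : z.im = 0 := by
    rw [hz, viewRatio_im, ← edgeVec, hcr, zero_div]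
  have hre : z.re < 0 := by
    obtain ⟨s, hs0, hs1, hs⟩ := Q.mem_openEdge.mp hq
    have hA : toComplex (Q.poly i - q) ≠ 0 := by
      rw [Ne, toComplex_eq_zero, sub_eq_zero]; exact hqa.symm
    have h1 : z = ((-((1 - s) / s) : ℝ) : ℂ) := by
      rw [hz, viewRatio, div_eq_iff hA, hs, poly_succ]
      apply Complex.ext
      · simp [toComplex]; field_simp
      · simp [toComplex]; field_simp
    rw [h1, Complex.ofReal_re]
    have : 0 < (1 - s) / s := div_pos (by linarith) hs0
    linarith
  have hc : Tendsto (fun t : ℝ => viewRatio (Q.poly i) (Q.poly (i + 1))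
      (q + (η * t) • Q.corner i)) (𝓝[>] 0) (𝓝 z) := by
    have h1 : Tendsto (fun t : ℝ => q + (η * t) • Q.corner i) (𝓝[>] 0) (𝓝 q) := by
      have : Continuous fun t : ℝ => q + (η * t) • Q.corner i := by fun_prop
      have := this.tendsto 0
      simp only [mul_zero, zero_smul, add_zero] at this
      exact this.mono_left nhdsWithin_le_nhds
    exact (continuousAt_viewRatio hqa).tendsto.comp h1
  have hsign : ∀ t : ℝ, (viewRatio (Q.poly i) (Q.poly (i + 1)) (q + (η * t) • Q.corner i)).im =
      (η * t) / Complex.normSq (toComplex (Q.poly i - (q + (η * t) • Q.corner i))) := by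
    intro t
    rw [viewRatio_im, ← edgeVec, add_sub_right_comm, cross_add_right, hcr, cross_smul_right,
      cross_edgeVec_corner, zero_add, mul_one]
  rcases hη with rfl | rfl
  · rw [one_mul]
    refine (Complex.tendsto_arg_nhdsWithin_im_nonneg_of_re_neg_of_im_zero hre him).comp
      (tendsto_nhdsWithin_iff.mpr ⟨hc, ?_⟩)
    filter_upwards [self_mem_nhdsWithin] with t ht
    rw [hsign, one_mul]
    exact div_nonneg (le_of_lt ht) (Complex.normSq_nonneg _)
  · rw [neg_one_mul]
    refine (Complex.tendsto_arg_nhdsWithin_im_neg_of_re_neg_of_im_zero hre him).comp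
      (tendsto_nhdsWithin_iff.mpr ⟨hc, ?_⟩)
    have hev : ∀ᶠ t in 𝓝[>] (0 : ℝ), q + (-1 * t) • Q.corner i ≠ Q.poly i := by
      have : Continuous fun t : ℝ => q + (-1 * t) • Q.corner i := by fun_prop
      have h0 := this.tendsto 0
      simp only [mul_zero, zero_smul, add_zero] at h0
      exact (h0.mono_left nhdsWithin_le_nhds).eventually_ne hqa
    filter_upwards [self_mem_nhdsWithin, hev] with t ht hne
    rw [hsign]
    have ht0 : 0 < t := ht
    refine div_neg_of_neg_of_pos (by linarith) (Complex.normSq_pos.mpr ?_)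
    rw [Ne, toComplex_eq_zero, sub_eq_zero]; exact hne.symm

-- The other edges contribute continuously, with sum `L` at `q`, so the total angle jumps by 2π
-- across edge `i`.
open Filter Topology in
lemma exists_tendsto_totalAngle {i : Fin (Q.m + 3)} {q : Plane} (hq : q ∈ Q.openEdge i) :
    ∃ L : ℝ, ∀ η : ℝ, (η = 1 ∨ η = -1) →
      Tendsto (fun t : ℝ => Q.totalAngle (q + (η * t) • Q.corner i)) (𝓝[>] 0)
        (𝓝 (η * Real.pi + L)) := by
  refine ⟨∑ j ∈ Finset.univ.erase i, Q.viewAngle j q, fun η hη => ?_⟩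
  have h1 : ∀ p, Q.totalAngle p = Q.viewAngle i p + ∑ j ∈ Finset.univ.erase i, Q.viewAngle j p :=
    fun p => (Finset.add_sum_erase _ _ (Finset.mem_univ i)).symm
  simp_rw [h1]
  refine (Q.tendsto_viewAngle hq hη).add (tendsto_finsetSum _ fun j hj => ?_)
  have h2 := Q.continuousAt_viewAngle
    (Q.notMem_closedEdge_of_mem_openEdge hq (Finset.ne_of_mem_erase hj))
  refine h2.tendsto.comp ?_
  have : Continuous fun t : ℝ => q + (η * t) • Q.corner i := by fun_prop
  have h0 := this.tendsto 0
  simp only [mul_zero, zero_smul, add_zero] at h0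
  exact h0.mono_left nhdsWithin_le_nhds

lemma midpoint_mem_openEdge (i : Fin (Q.m + 3)) :
    Q.poly i + (1 / 2 : ℝ) • Q.edgeVec i ∈ Q.openEdge i :=
  Q.mem_openEdge.mpr ⟨1 / 2, by norm_num, by norm_num, rfl⟩

open Filter Topology in
/-- The Jordan curve theorem near the curve: exactly one of the two sides is inside. -/
theorem exists_inner_side : ∃ η : ℝ, (η = 1 ∨ η = -1) ∧
    ∀ i, ∀ q ∈ Q.openEdge i, ∃ r > 0, ∀ p ∈ Metric.ball q r,
      (0 < η * cross (Q.edgeVec i) (p - Q.poly i) → p ∈ Q.inside) ∧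
      (η * cross (Q.edgeVec i) (p - Q.poly i) < 0 → p ∉ Q.inside) := by
  obtain ⟨σ, hσ, hray⟩ := Q.exists_sides
  -- If both sides were outside, the total angle would vanish on both, although its one-sided limits
  -- are `π + L` and `-π + L`.
  have hin : σ 1 ∈ Q.inside ∨ σ (-1) ∈ Q.inside := by
    by_contra! h
    have hq := Q.midpoint_mem_openEdge 0
    set q := Q.poly 0 + (1 / 2 : ℝ) • Q.edgeVec 0
    obtain ⟨r, hr, hball⟩ := hσ 0 q hq
    obtain ⟨L, hL⟩ := Q.exists_tendsto_totalAngle hq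
    have hcr : cross (Q.edgeVec 0) (q - Q.poly 0) = 0 :=
      Q.cross_of_mem_closedEdge (Q.openEdge_subset_closedEdge 0 hq)
    have key : ∀ η : ℝ, (η = 1 ∨ η = -1) → η * Real.pi + L = 0 := by
      intro η hη
      have hout : σ η ∉ Q.inside := by rcases hη with rfl | rfl; exacts [h.1, h.2]
      have hcont : Continuous fun t : ℝ => q + (η * t) • Q.corner 0 := by fun_prop
      have h0 := hcont.tendsto 0
      simp only [mul_zero, zero_smul, add_zero] at h0
      have hev : ∀ᶠ t in 𝓝[>] (0 : ℝ), 0 = Q.totalAngle (q + (η * t) • Q.corner 0) := by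
        filter_upwards [self_mem_nhdsWithin,
          (h0.mono_left nhdsWithin_le_nhds).eventually (Metric.ball_mem_nhds q hr)] with t ht hb
        have hlink := hball _ hb η hη (by
          rw [add_sub_right_comm, cross_add_right, hcr, cross_smul_right, cross_edgeVec_corner]
          have ht0 : 0 < t := ht
          rcases hη with rfl | rfl <;> linarith)
        exact (Q.totalAngle_eq_zero (connectedComponentIn_subset _ _ hlink.mem_connectedComponentIn)
          fun h' => hout (hlink.mem_inside_iff.mpr h')).symm
      exact tendsto_nhds_unique (hL η hη) (tendsto_const_nhds.congr' hev)
    have h1 := key 1 (Or.inl rfl)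
    have h2 := key (-1) (Or.inr rfl)
    have := Real.pi_pos
    linarith
  -- From a rightmost vertex, the ray along `± corner` on which the first coordinate grows avoids
  -- the curve and is unbounded, so its side is outside.
  have hout : σ 1 ∉ Q.inside ∨ σ (-1) ∉ Q.inside := by
    obtain ⟨i, -, hi⟩ := Finset.exists_max_image Finset.univ (fun i => (Q.poly i).1)
      Finset.univ_nonempty
    have hmax : ∀ y ∈ Q.curve, y.1 ≤ (Q.poly i).1 := by
      intro y hy
      rw [curve_eq, mem_iUnion] at hy
      obtain ⟨j, a, b, ha, hb, hab, rfl⟩ := hy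
      have h1 := hi j (Finset.mem_univ _)
      have h2 := hi (j + 1) (Finset.mem_univ _)
      simp only [Prod.fst_add, Prod.smul_fst, smul_eq_mul]
      calc a * (Q.poly j).1 + b * (Q.poly (j + 1)).1
          ≤ a * (Q.poly i).1 + b * (Q.poly i).1 := by gcongr
        _ = (Q.poly i).1 := by rw [← add_mul, hab, one_mul]
    have hray' : ∀ η : ℝ, (η = 1 ∨ η = -1) → 0 < η * (Q.corner i).1 → σ η ∉ Q.inside := by
      intro η hη hpos hins
      obtain ⟨δ, hδ, hl⟩ := hray η hη i
      rw [hl.mem_inside_iff] at hins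
      set f : ℝ → Plane := fun t => Q.poly i + (η * t) • Q.corner i with hf
      have hsub : f '' Ioi 0 ⊆ connectedComponentIn Q.curveᶜ (f δ) := by
        refine (isPreconnected_Ioi.image f (by rw [hf]; fun_prop)).subset_connectedComponentIn
          (mem_image_of_mem f hδ) ?_
        rintro _ ⟨t, ht, rfl⟩ hmem
        have h1 := hmax _ hmem
        simp only [hf, Prod.fst_add, Prod.smul_fst, smul_eq_mul] at h1
        have := mul_pos hpos ht
        linarith
      have hb := hins.2.subset hsub
      obtain ⟨R, hR⟩ := hb.exists_norm_le
      set c := η * (Q.corner i).1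
      set t := (|R| + |(Q.poly i).1| + 1) / c with ht
      have ht0 : 0 < t := by positivity
      have h1 := hR _ (mem_image_of_mem f ht0)
      have h2 : (f t).1 ≤ R := ((le_abs_self _).trans (le_max_left _ _)).trans h1
      have h3 : (f t).1 = (Q.poly i).1 + c * t := by
        simp only [hf, Prod.fst_add, Prod.smul_fst, smul_eq_mul, c]; ring
      have h4 : c * t = |R| + |(Q.poly i).1| + 1 := by rw [ht]; field_simp
      have h5 := le_abs_self R
      have h6 := neg_abs_le (Q.poly i).1
      linarith
    -- A vertical corner vector would give both edges at vertex `i` the same nonzero horizontal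
    -- sign, whereas at a rightmost vertex the curve does not arrive leftward or leave rightward.
    have hne : (Q.corner i).1 ≠ 0 := by
      intro h0
      have h1 := Q.cross_edgeVec_corner i
      have h2 := Q.cross_edgeVec_corner_succ (i - 1)
      rw [sub_add_cancel] at h2
      have h3 := hi (i + 1) (Finset.mem_univ _)
      have h4 := hi (i - 1) (Finset.mem_univ _)
      simp only [cross, h0, mul_zero, sub_zero, edgeVec, sub_add_cancel, Prod.fst_sub] at h1 h2
      have h5 : 0 ≤ (Q.corner i).2 * (Q.corner i).2 := mul_self_nonneg _
      have h6 : (Q.corner i).2 ≠ 0 := by intro h; rw [h] at h1; simp at h1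
      rcases lt_or_gt_of_ne h6 with h7 | h7 <;> nlinarith
    rcases lt_or_gt_of_ne hne with h | h
    · exact Or.inr (hray' (-1) (Or.inr rfl) (by linarith))
    · exact Or.inl (hray' 1 (Or.inl rfl) (by linarith))
  obtain ⟨η, hη, h1, h2⟩ : ∃ η : ℝ, (η = 1 ∨ η = -1) ∧ σ η ∈ Q.inside ∧ σ (-η) ∉ Q.inside := by
    rcases hin with h | h
    · exact ⟨1, Or.inl rfl, h, hout.resolve_left (not_not.mpr h)⟩
    · exact ⟨-1, Or.inr rfl, h, by rw [neg_neg]; exact hout.resolve_right (not_not.mpr h)⟩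
  refine ⟨η, hη, fun i q hq => ?_⟩
  obtain ⟨r, hr, hb⟩ := hσ i q hq
  refine ⟨r, hr, fun p hp => ⟨fun hs => ?_, fun hs => ?_⟩⟩
  · exact (hb p hp η hη hs).mem_inside_iff.mp h1
  · have hη' : -η = 1 ∨ -η = -1 := by rcases hη with rfl | rfl <;> simp
    exact fun hp' => h2 ((hb p hp (-η) hη' (by linarith)).mem_inside_iff.mpr hp')

end EmbeddedPolygon

/-! ### Existence and uniqueness of chords. -/

lemma mem_openSegment_iff_add_smul {x z y : Plane} :
    y ∈ openSegment ℝ x z ↔ ∃ τ : ℝ, 0 < τ ∧ τ < 1 ∧ y = x + τ • (z - x) := by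
  rw [openSegment_eq_image']
  constructor
  · rintro ⟨τ, ⟨h0, h1⟩, rfl⟩; exact ⟨τ, h0, h1, rfl⟩
  · rintro ⟨τ, h0, h1, rfl⟩; exact ⟨τ, ⟨h0, h1⟩, rfl⟩

namespace EmbeddedPolygon

variable (Q : EmbeddedPolygon)

lemma inside_subset_compl_curve : Q.inside ⊆ Q.curveᶜ := fun _ h => h.1

lemma mem_inside_of_isPreconnected {S : Set Plane} (hS : IsPreconnected S) (hc : S ⊆ Q.curveᶜ)
    {p : Plane} (hp : p ∈ S) (hin : p ∈ Q.inside) : S ⊆ Q.inside := fun _ hq =>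
  (Linked.mem_inside_iff ⟨S, hc, hS, hp, hq⟩).mp hin

/-- A chord from a point of the curve that starts on the inner side of an open edge. -/
lemma existsUnique_chord_of_inner {q g : Plane} {r : ℝ} (hr : 0 < r)
    (hpos : ∀ t : ℝ, 0 < t → t < r → q + t • g ∈ Q.inside)
    (hneg : ∀ t : ℝ, 0 < t → t < r → q - t • g ∉ Q.inside) (hg : g ≠ 0) :
    ∃! z, z ∈ Q.curve ∧ (∃ t : ℝ, z = q + t • g) ∧ z ≠ q ∧ openSegment ℝ q z ⊆ Q.inside := by
  set f : ℝ → Plane := fun t => q + t • g with hf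
  have hfc : Continuous f := by rw [hf]; fun_prop
  -- Starting at `r / 2` excludes a hit at `t = 0` and keeps `T` closed; nothing is lost, as the ray
  -- is inside for `0 < t < r`. The chord ends at the first hit `sInf T`.
  set T : Set ℝ := Ici (r / 2) ∩ f ⁻¹' Q.curve with hT
  have hsub : ∀ b : ℝ, r / 2 < b → (∀ t, r / 2 ≤ t → t < b → f t ∉ Q.curve) →
      f '' Ioo 0 b ⊆ Q.inside := by
    intro b hb h
    refine Q.mem_inside_of_isPreconnected (isPreconnected_Ioo.image f hfc.continuousOn) ?_
      (mem_image_of_mem f (⟨by linarith, hb⟩ : r / 2 ∈ Ioo 0 b))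
      (hpos _ (by linarith) (by linarith))
    rintro _ ⟨t, ht, rfl⟩
    rcases lt_or_ge t (r / 2) with h' | h'
    · exact (hpos t ht.1 (by linarith)).1
    · exact h t h' ht.2
  have hTne : T.Nonempty := by
    by_contra hne
    rw [not_nonempty_iff_eq_empty] at hne
    have hoff : ∀ t, r / 2 ≤ t → f t ∉ Q.curve := fun t ht hm => by
      have : t ∈ T := ⟨ht, hm⟩
      rw [hne] at this; exact this
    have hin : f (r / 2) ∈ Q.inside := hpos _ (by linarith) (by linarith)
    have hb := hin.2.subset ((isPreconnected_Ici.image f hfc.continuousOn).subset_connectedComponentIn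
        (mem_image_of_mem f (self_mem_Ici : r / 2 ∈ Ici (r / 2))) (by
          rintro _ ⟨t, ht, rfl⟩; exact hoff t ht))
    obtain ⟨R, hR⟩ := hb.exists_norm_le
    have hg0 : 0 < ‖g‖ := norm_pos_iff.mpr hg
    set t := max (r / 2) ((|R| + ‖q‖ + 1) / ‖g‖) with ht
    have h1 := hR _ (mem_image_of_mem f (mem_Ici.mpr (le_max_left _ _) : t ∈ Ici (r / 2)))
    have ht0 : 0 < t := lt_of_lt_of_le (by linarith) (le_max_left (r / 2) _)
    have h2 : |R| + ‖q‖ + 1 ≤ t * ‖g‖ := by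
      rw [← div_le_iff₀ hg0]; exact le_max_right _ _
    have h3 : ‖t • g‖ ≤ ‖f t‖ + ‖q‖ := by
      have : t • g = f t - q := by simp [hf]
      rw [this]; exact norm_sub_le _ _
    rw [norm_smul, Real.norm_eq_abs, abs_of_pos ht0] at h3
    have := le_abs_self R
    linarith
  have hTc : IsClosed T := isClosed_Ici.inter (Q.isCompact_curve.isClosed.preimage hfc)
  have hTb : BddBelow T := ⟨r / 2, fun t ht => ht.1⟩
  set b := sInf T with hb
  have hbT : b ∈ T := hTc.csInf_mem hTne hTb
  have hb1 : r / 2 < b := lt_of_le_of_ne hbT.1 fun e =>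
    (hpos (r / 2) (by linarith) (by linarith)).1 (e ▸ hbT.2)
  have hbin := hsub b hb1 fun t h1 h2 hm => (not_le.mpr h2) (csInf_le hTb ⟨h1, hm⟩)
  have hne : ∀ t : ℝ, t ≠ 0 → f t ≠ q := by
    intro t ht h
    have : t • g = 0 := by simpa [hf] using h
    rcases smul_eq_zero.mp this with h | h
    exacts [ht h, hg h]
  have hseg : ∀ t u τ : ℝ, t = τ * u → q + τ • (f u - q) = f t := by
    rintro t u τ rfl
    simp only [hf, add_sub_cancel_left, smul_smul]
  refine ⟨f b, ⟨hbT.2, ⟨b, rfl⟩, hne b (by linarith), ?_⟩, ?_⟩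
  · intro y hy
    obtain ⟨τ, h0, h1, rfl⟩ := mem_openSegment_iff_add_smul.mp hy
    rw [hseg _ b τ rfl]
    have hb0 : 0 < b := by linarith
    exact hbin (mem_image_of_mem f ⟨by positivity, by nlinarith⟩)
  · rintro z ⟨hzc, ⟨t, rfl⟩, hzq, hzin⟩
    change openSegment ℝ q (f t) ⊆ Q.inside at hzin
    change f t ∈ Q.curve at hzc
    change f t = f b
    have key : ∀ τ : ℝ, 0 < τ → τ < 1 → f (τ * t) ∈ Q.inside := by
      intro τ h0 h1
      rw [← hseg _ t τ rfl]
      exact hzin (mem_openSegment_iff_add_smul.mpr ⟨τ, h0, h1, rfl⟩)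
    -- A chord with `t < 0` would begin outside, and one with `t > b` would cross the curve at
    -- parameter `b`.
    rcases lt_trichotomy t 0 with h | h | h
    · exfalso
      set u := min (r / 2) (-t / 2) with hu
      have hu0 : 0 < u := lt_min (by linarith) (by linarith)
      have hur : u ≤ r / 2 := min_le_left _ _
      have hut : u ≤ -t / 2 := min_le_right _ _
      refine hneg u hu0 (by linarith) ?_
      have := key (u / -t) (by apply div_pos <;> linarith)
        (by rw [div_lt_one] <;> linarith)
      have e : u / -t * t = -u := by rw [div_neg, neg_mul, div_mul_cancel₀ _ h.ne]
      rw [e] at this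
      simpa [hf, sub_eq_add_neg] using this
    · subst h; simp at hzq
    · have htr : r / 2 ≤ t := by
        by_contra h'
        exact (hpos t h (by linarith)).1 hzc
      have hbt : b ≤ t := csInf_le hTb ⟨htr, hzc⟩
      rcases hbt.eq_or_lt with h' | h'
      · rw [h']
      · exfalso
        have := key (b / t) (by apply div_pos <;> linarith) (by rw [div_lt_one] <;> linarith)
        rw [div_mul_cancel₀ _ h.ne'] at this
        exact this.1 hbT.2

/-- From a point of an open edge there is exactly one chord in each transversal direction. -/
theorem existsUnique_chord {i : Fin (Q.m + 3)} {q d : Plane} (hq : q ∈ Q.openEdge i)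
    (hd : cross (Q.edgeVec i) d ≠ 0) :
    ∃! z, z ∈ Q.curve ∧ (∃ t : ℝ, z = q + t • d) ∧ z ≠ q ∧ openSegment ℝ q z ⊆ Q.inside := by
  obtain ⟨η, hη, hside⟩ := Q.exists_inner_side
  obtain ⟨r, hr, hball⟩ := hside i q hq
  have hcr : cross (Q.edgeVec i) (q - Q.poly i) = 0 :=
    Q.cross_of_mem_closedEdge (Q.openEdge_subset_closedEdge i hq)
  have key : ∀ c : ℝ, c ≠ 0 → 0 < η * cross (Q.edgeVec i) (c • d) →
      ∃! z, z ∈ Q.curve ∧ (∃ t : ℝ, z = q + t • d) ∧ z ≠ q ∧ openSegment ℝ q z ⊆ Q.inside := by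
    intro c hc hpos
    have hg : c • d ≠ 0 := by intro h; rw [h] at hpos; simp [cross] at hpos
    have hg0 : 0 < ‖c • d‖ := norm_pos_iff.mpr hg
    have hmem : ∀ t : ℝ, |t| < r / ‖c • d‖ → q + t • (c • d) ∈ Metric.ball q r := by
      intro t ht
      rw [mem_ball_iff_norm, add_sub_cancel_left, norm_smul, Real.norm_eq_abs]
      rwa [← lt_div_iff₀ hg0]
    have hcross : ∀ t : ℝ, η * cross (Q.edgeVec i) (q + t • (c • d) - Q.poly i) =
        t * (η * cross (Q.edgeVec i) (c • d)) := by
      intro t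
      rw [add_sub_right_comm, cross_add_right, hcr, cross_smul_right _ _ t]; ring
    have h := Q.existsUnique_chord_of_inner (div_pos hr hg0)
      (g := c • d)
      (fun t h0 h1 => (hball _ (hmem t (by rwa [abs_of_pos h0]))).1
        (by rw [hcross]; exact mul_pos h0 hpos))
      (fun t h0 h1 => by
        have := (hball _ (hmem (-t) (by rwa [abs_neg, abs_of_pos h0]))).2
          (by rw [hcross]; nlinarith)
        rwa [neg_smul, ← sub_eq_add_neg] at this) hg
    have hiff : ∀ z, (∃ t : ℝ, z = q + t • (c • d)) ↔ ∃ t : ℝ, z = q + t • d := by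
      intro z
      constructor
      · rintro ⟨t, rfl⟩; exact ⟨t * c, by rw [smul_smul]⟩
      · rintro ⟨t, rfl⟩; exact ⟨t / c, by rw [smul_smul, div_mul_cancel₀ _ hc]⟩
    simpa only [hiff] using h
  have hne : η * cross (Q.edgeVec i) d ≠ 0 := by
    refine mul_ne_zero ?_ hd
    rcases hη with rfl | rfl <;> norm_num
  rcases lt_or_gt_of_ne hne with h | h
  · exact key (-1) (by norm_num) (by rw [cross_smul_right]; linarith)
  · exact key 1 one_ne_zero (by rwa [one_smul])

/-- A chord is not parallel to an open edge in which it ends. -/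
lemma cross_ne_zero_of_chord {i : Fin (Q.m + 3)} {x z d : Plane} (hz : z ∈ Q.openEdge i)
    {t : ℝ} (ht : z = x + t • d) (hin : openSegment ℝ x z ⊆ Q.inside) :
    cross (Q.edgeVec i) d ≠ 0 := by
  intro hcr
  obtain ⟨c, rfl⟩ := exists_eq_smul_of_cross_eq_zero (Q.edgeVec_ne_zero i) hcr
  obtain ⟨s, hs0, hs1, hs⟩ := Q.mem_openEdge.mp hz
  set u := t * c with hu
  -- `δ` is the room left in the edge around `z`. With `τ` this small, the chord point at parameter
  -- `1 - τ` is still on the open edge, hence not inside.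
  set δ := min s (1 - s) with hδ
  have hδ0 : 0 < δ := lt_min hs0 (by linarith)
  have hδs : δ ≤ s := min_le_left _ _
  have hδs' : δ ≤ 1 - s := min_le_right _ _
  have hab := abs_nonneg u
  set τ := δ / (|u| + 1) with hτ
  have hτ0 : 0 < τ := by positivity
  have hτ1 : τ < 1 := by rw [hτ, div_lt_one (by linarith)]; linarith
  have hτe : τ * (|u| + 1) = δ := by rw [hτ]; field_simp
  have hτu : |τ * u| < δ := by rw [abs_mul, abs_of_pos hτ0]; nlinarith
  obtain ⟨h1, h2⟩ := abs_lt.mp hτu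
  have hy : Q.poly i + (s - τ * u) • Q.edgeVec i ∈ Q.openEdge i :=
    Q.mem_openEdge.mpr ⟨s - τ * u, by linarith, by linarith, rfl⟩
  refine Q.inside_subset_compl_curve (hin ?_) (Q.openEdge_subset_curve i hy)
  rw [mem_openSegment_iff_add_smul]
  refine ⟨1 - τ, by linarith, by linarith, ?_⟩
  have hx : x = z - u • Q.edgeVec i := by rw [ht, hu, smul_smul]; abel
  rw [hx, hs]; module

end EmbeddedPolygon

/-! ### Reversibility of the billiard map and existence of orbits. -/

variable {P : Bool → EmbeddedPolygon}

lemma EmbeddedPolygon.mem_tangent {Q : EmbeddedPolygon} {y d : Plane} {j : Fin (Q.m + 3)}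
    (hy : y ∈ Q.openEdge j) : d ∈ Q.tangent y ↔ ∃ t : ℝ, d = t • Q.edgeVec j := by
  constructor
  · rintro ⟨k, hk, hd⟩
    rw [Q.openEdge_index_unique hk hy, Q.edgeDirection_eq, Submodule.mem_span_singleton] at hd
    obtain ⟨t, rfl⟩ := hd
    exact ⟨t, rfl⟩
  · rintro ⟨t, rfl⟩
    refine ⟨j, hy, ?_⟩
    rw [Q.edgeDirection_eq]
    exact Submodule.smul_mem _ _ (Submodule.mem_span_singleton_self _)

lemma isReflection_iff {s s' : Bool} (hs : s' = !s) {x y z : Plane} {j : Fin ((P s').m + 3)}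
    (hy : y ∈ (P s').openEdge j) : IsReflection P ⟨s, x, y⟩ z ↔
      z ∈ (P s).curve ∧ (∃ t : ℝ, z = x + t • (P s').edgeVec j) ∧ z ≠ x ∧
        openSegment ℝ x z ⊆ (P s).inside := by
  subst hs
  simp only [IsReflection, EmbeddedPolygon.mem_tangent hy, sub_eq_iff_eq_add']

lemma mem_maxPhaseSpace {s s' : Bool} (hs : s' = !s) {x y : Plane} {i : Fin ((P s).m + 3)}
    {j : Fin ((P s').m + 3)} (hx : x ∈ (P s).openEdge i) (hy : y ∈ (P s').openEdge j)
    (hc : cross ((P s).edgeVec i) ((P s').edgeVec j) ≠ 0) : ⟨s, x, y⟩ ∈ maxPhaseSpace P := by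
  have h := (P s).existsUnique_chord hx hc
  simp only [← isReflection_iff hs hy] at h
  subst hs
  exact ⟨⟨(P s).openEdge_subset_curve i hx, (P !s).openEdge_subset_curve j hy⟩,
    (P !s).notMem_vertexSet_of_mem_openEdge hy, h⟩

lemma IsReflection.symm {s : Bool} {x y z : Plane} (hx : x ∈ (P s).curve)
    (h : IsReflection P ⟨s, x, y⟩ z) : IsReflection P ⟨s, z, y⟩ x := by
  obtain ⟨-, ⟨j, hj, hd⟩, hne, hin⟩ := h
  refine ⟨hx, ⟨j, hj, ?_⟩, hne.symm, by rwa [openSegment_symm]⟩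
  rw [← neg_sub]
  exact Submodule.neg_mem _ hd

lemma IsReflection.cross_ne_zero {s s' : Bool} (hs : s' = !s) {x y z : Plane}
    {i : Fin ((P s).m + 3)} {j : Fin ((P s').m + 3)} (h : IsReflection P ⟨s, x, y⟩ z)
    (hz : z ∈ (P s).openEdge i) (hy : y ∈ (P s').openEdge j) :
    cross ((P s).edgeVec i) ((P s').edgeVec j) ≠ 0 := by
  obtain ⟨-, ⟨t, ht⟩, -, hin⟩ := (isReflection_iff hs hy).mp h
  exact (P s).cross_ne_zero_of_chord hz ht hin

variable (P)

/-- One step of the billiard map. -/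
def Step (a b : PhasePoint) : Prop := ∃ h : a ∈ maxPhaseSpace P, billiardMap P ⟨a, h⟩ = b

variable {P}

lemma step_iff {a b : PhasePoint} : Step P a b ↔
    a ∈ maxPhaseSpace P ∧ b.sign = (!a.sign) ∧ b.fst = a.snd ∧ IsReflection P a b.snd := by
  constructor
  · rintro ⟨h, rfl⟩
    exact ⟨h, rfl, rfl, Classical.choose_spec h.2.2.exists⟩
  · rintro ⟨h, h1, h2, h3⟩
    refine ⟨h, PhasePoint.ext h1.symm h2.symm ?_⟩
    exact h.2.2.unique (Classical.choose_spec h.2.2.exists) h3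

lemma Step.unique {a b c : PhasePoint} (hb : Step P a b) (hc : Step P a c) : b = c := by
  obtain ⟨h, rfl⟩ := hb
  obtain ⟨h', rfl⟩ := hc
  rfl

@[simp]
lemma PhasePoint.swap_swap (a : PhasePoint) : a.swap.swap = a := by
  simp [PhasePoint.swap]

lemma tablePairs_swap {a : PhasePoint} (h : a ∈ tablePairs P) : a.swap ∈ tablePairs P := by
  refine ⟨h.2, ?_⟩
  simpa [PhasePoint.swap] using h.1

lemma Step.mem_tablePairs {a b : PhasePoint} (h : Step P a b) : b ∈ tablePairs P := by
  obtain ⟨h1, h2, h3, h4⟩ := step_iff.mp h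
  obtain ⟨s, x, y⟩ := b
  obtain rfl : s = !a.sign := h2
  obtain rfl : x = a.snd := h3
  refine ⟨h1.1.2, ?_⟩
  simpa using h4.1

lemma exists_snd_mem_openEdge {a : PhasePoint} (h : a ∈ maxPhaseSpace P) :
    ∃ j, a.snd ∈ (P (!a.sign)).openEdge j :=
  (P (!a.sign)).exists_mem_openEdge h.1.2 h.2.1

/-- The billiard map is reversed by the swap map. -/
lemma Step.reverse {a b : PhasePoint} (h : Step P a b) (hv : b.snd ∉ (P a.sign).vertexSet) :
    b ∈ maxPhaseSpace P ∧ Step P b.swap a.swap := by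
  obtain ⟨hmax, h2, h3, hrefl⟩ := step_iff.mp h
  obtain ⟨s, x, y⟩ := a
  obtain ⟨s', y', z⟩ := b
  obtain rfl : s' = !s := h2
  obtain rfl : y' = y := h3
  obtain ⟨j, hy⟩ := exists_snd_mem_openEdge hmax
  obtain ⟨i, hz⟩ := (P s).exists_mem_openEdge hrefl.1 hv
  -- Transversality at the end `z` of the chord is what makes both `(y, z)` and `(z, y)` admissible.
  have hc := hrefl.cross_ne_zero rfl hz hy
  refine ⟨mem_maxPhaseSpace (by simp) hy hz ?_, step_iff.mpr ⟨?_, by simp [PhasePoint.swap], rfl, ?_⟩⟩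
  · rw [cross_swap]; exact neg_ne_zero.mpr hc
  · have := mem_maxPhaseSpace rfl hz hy hc
    simpa [PhasePoint.swap] using this
  · have := hrefl.symm hmax.1.1
    simpa [PhasePoint.swap] using this

lemma swap_mem_maxPhaseSpace {a : PhasePoint} (h : a ∈ maxPhaseSpace P)
    (hv : a.fst ∉ (P a.sign).vertexSet) : a.swap ∈ maxPhaseSpace P := by
  obtain ⟨s, x, y⟩ := a
  obtain ⟨z, hz⟩ := h.2.2.exists
  obtain ⟨j, hy⟩ := exists_snd_mem_openEdge h
  obtain ⟨i, hx⟩ := (P s).exists_mem_openEdge h.1.1 hv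
  have hc := (hz.symm h.1.1).cross_ne_zero rfl hx hy
  refine mem_maxPhaseSpace (by simp) hy hx ?_
  rw [cross_swap]; exact neg_ne_zero.mpr hc

lemma mem_discontinuitySet {a : PhasePoint} : a ∈ discontinuitySet P ↔
    a ∈ ⋃ i, discontinuityStep P i ∨ a.swap ∈ ⋃ i, discontinuityStep P i := by
  rw [discontinuitySet, mem_union]
  refine or_congr Iff.rfl ⟨?_, fun h => ⟨_, h, by simp⟩⟩
  rintro ⟨b, hb, rfl⟩
  simpa using hb

lemma mem_iUnion_discontinuityStep {a : PhasePoint} : a ∈ ⋃ i, discontinuityStep P i ↔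
    (a ∈ tablePairs P ∧ a.snd ∈ (P (!a.sign)).vertexSet) ∨
      ∃ b, Step P a b ∧ b ∈ ⋃ i, discontinuityStep P i := by
  simp only [mem_iUnion]
  constructor
  · rintro ⟨_ | i, hi⟩
    · exact Or.inl hi
    · obtain ⟨h, hb⟩ := hi
      exact Or.inr ⟨_, ⟨h, rfl⟩, i, hb⟩
  · rintro (h | ⟨b, ⟨h, rfl⟩, i, hi⟩)
    · exact ⟨0, h⟩
    · exact ⟨i + 1, h, hi⟩

lemma fst_notMem_vertexSet {a : PhasePoint} (h : a ∈ phaseSpace P) :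
    a.fst ∉ (P a.sign).vertexSet := by
  intro hv
  refine h.2 (mem_discontinuitySet.mpr (Or.inr (mem_iUnion_discontinuityStep.mpr (Or.inl
    ⟨tablePairs_swap h.1.1, ?_⟩))))
  simpa [PhasePoint.swap] using hv

lemma swap_mem_phaseSpace {a : PhasePoint} (h : a ∈ phaseSpace P) : a.swap ∈ phaseSpace P := by
  refine ⟨swap_mem_maxPhaseSpace h.1 (fst_notMem_vertexSet h), fun hd => h.2 ?_⟩
  rw [mem_discontinuitySet] at hd ⊢
  rw [PhasePoint.swap_swap] at hd
  exact hd.symm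

lemma Step.snd_notMem_vertexSet {a b : PhasePoint} (ha : a ∈ phaseSpace P) (h : Step P a b) :
    b.snd ∉ (P a.sign).vertexSet := by
  intro hv
  refine ha.2 (mem_discontinuitySet.mpr (Or.inl (mem_iUnion_discontinuityStep.mpr (Or.inr
    ⟨b, h, mem_iUnion_discontinuityStep.mpr (Or.inl ⟨h.mem_tablePairs, ?_⟩)⟩))))
  rw [(step_iff.mp h).2.1, Bool.not_not]
  exact hv

/-- A singular future of `b` is a singular future of `a`. Since `b.swap` steps to `a.swap`, a
singular future of `b.swap` either makes `a.snd` a vertex or is one of `a.swap`. -/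
lemma Step.mem_phaseSpace {a b : PhasePoint} (ha : a ∈ phaseSpace P) (h : Step P a b) :
    b ∈ phaseSpace P := by
  obtain ⟨hmax, hrev⟩ := h.reverse (h.snd_notMem_vertexSet ha)
  refine ⟨hmax, fun hd => ha.2 ?_⟩
  rw [mem_discontinuitySet] at hd ⊢
  rcases hd with hd | hd
  · exact Or.inl (mem_iUnion_discontinuityStep.mpr (Or.inr ⟨b, h, hd⟩))
  · rcases mem_iUnion_discontinuityStep.mp hd with ⟨-, hv⟩ | ⟨c, hc, hcN⟩
    · exfalso
      obtain ⟨-, h1, h2, -⟩ := step_iff.mp h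
      refine ha.1.2.1 ?_
      simpa [PhasePoint.swap, h1, h2] using hv
    · rw [← hrev.unique hc] at hcN
      exact Or.inr hcN

lemma Step.injective {a a' b : PhasePoint} (ha : a ∈ phaseSpace P) (ha' : a' ∈ phaseSpace P)
    (h : Step P a b) (h' : Step P a' b) : a = a' := by
  have h1 := (h.reverse (h.snd_notMem_vertexSet ha)).2
  have h2 := (h'.reverse (h'.snd_notMem_vertexSet ha')).2
  simpa using congrArg PhasePoint.swap (h1.unique h2)

lemma exists_step_to {b : PhasePoint} (hb : b ∈ phaseSpace P) :
    ∃ a ∈ phaseSpace P, Step P a b := by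
  have hb' := swap_mem_phaseSpace hb
  obtain ⟨c, hc⟩ : ∃ c, Step P b.swap c := ⟨_, hb'.1, rfl⟩
  have h := (hc.reverse (hc.snd_notMem_vertexSet hb')).2
  rw [PhasePoint.swap_swap] at h
  exact ⟨c.swap, swap_mem_phaseSpace (hc.mem_phaseSpace hb'), h⟩

lemma IsOrbit.ext {o o' : ℤ → PhasePoint} (h : IsOrbit P o) (h' : IsOrbit P o')
    (h0 : o 0 = o' 0) : o = o' := by
  have hs : ∀ k, Step P (o k) (o (k + 1)) := h.2
  have hs' : ∀ k, Step P (o' k) (o' (k + 1)) := h'.2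
  funext k
  induction k using Int.induction_on with
  | zero => exact h0
  | succ i ih =>
    have := hs' i
    rw [← ih] at this
    exact (hs i).unique this
  | pred i ih =>
    have h1 := hs (-i - 1)
    have h2 := hs' (-i - 1)
    rw [sub_add_cancel] at h1 h2
    rw [← ih] at h2
    exact h1.injective (h.1 _) (h'.1 _) h2

/-- Through every point of the phase space there is exactly one orbit. -/
theorem existsUnique_orbit {p : PhasePoint} (hp : p ∈ phaseSpace P) :
    ∃! o : ℤ → PhasePoint, IsOrbit P o ∧ o 0 = p := by
  set F : phaseSpace P → phaseSpace P := fun a =>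
    ⟨billiardMap P ⟨a.1, a.2.1⟩, Step.mem_phaseSpace a.2 ⟨a.2.1, rfl⟩⟩ with hF
  have hFs : ∀ a : phaseSpace P, Step P a.1 (F a).1 := fun a => ⟨a.2.1, rfl⟩
  have hbij : Function.Bijective F := by
    refine ⟨fun a a' h => Subtype.ext ?_, fun b => ?_⟩
    · have h1 := hFs a
      rw [h] at h1
      exact h1.injective a.2 a'.2 (hFs a')
    · obtain ⟨a, ha, hab⟩ := exists_step_to b.2
      exact ⟨⟨a, ha⟩, Subtype.ext ((hFs ⟨a, ha⟩).unique hab)⟩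
  set e : Equiv.Perm (phaseSpace P) := Equiv.ofBijective F hbij with he
  refine ⟨fun k => ((e ^ k) ⟨p, hp⟩).1, ⟨⟨fun k => Subtype.prop _, fun k => ?_⟩, by simp⟩, ?_⟩
  · have h1 : (e ^ (k + 1)) ⟨p, hp⟩ = F ((e ^ k) ⟨p, hp⟩) := by
      rw [add_comm, zpow_add, zpow_one]; rfl
    simp only [h1]
    exact hFs _
  · rintro o ⟨ho, ho0⟩
    refine IsOrbit.ext ho ⟨fun k => Subtype.prop _, fun k => ?_⟩ (by simp [ho0])
    have h1 : (e ^ (k + 1)) ⟨p, hp⟩ = F ((e ^ k) ⟨p, hp⟩) := by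
      rw [add_comm, zpow_add, zpow_one]; rfl
    simp only [h1]
    exact hFs _

/-! ### Integer direction vectors with sum zero. -/

/-- The integer points of the plane. -/
def IsLatticePoint (p : Plane) : Prop := ∃ a b : ℤ, p = ((a : ℝ), (b : ℝ))

lemma IsLatticePoint.add {p q : Plane} (hp : IsLatticePoint p) (hq : IsLatticePoint q) :
    IsLatticePoint (p + q) := by
  obtain ⟨a, b, rfl⟩ := hp
  obtain ⟨c, d, rfl⟩ := hq
  exact ⟨a + c, b + d, by simp⟩

lemma IsLatticePoint.sub {p q : Plane} (hp : IsLatticePoint p) (hq : IsLatticePoint q) :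
    IsLatticePoint (p - q) := by
  obtain ⟨a, b, rfl⟩ := hp
  obtain ⟨c, d, rfl⟩ := hq
  exact ⟨a - c, b - d, by simp⟩

lemma IsLatticePoint.exists_cross_eq {p q : Plane} (hp : IsLatticePoint p)
    (hq : IsLatticePoint q) : ∃ n : ℤ, cross p q = n := by
  obtain ⟨a, b, rfl⟩ := hp
  obtain ⟨c, d, rfl⟩ := hq
  exact ⟨a * d - b * c, by simp [cross]⟩

lemma IsLatticePoint.cross_smul {p q r : Plane} (hp : IsLatticePoint p)
    (hq : IsLatticePoint q) (hr : IsLatticePoint r) : IsLatticePoint (cross p q • r) := by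
  obtain ⟨n, hn⟩ := hp.exists_cross_eq hq
  obtain ⟨a, b, rfl⟩ := hr
  exact ⟨n * a, n * b, by simp [hn]⟩

lemma cross_smul_left (a b : Plane) (r : ℝ) : cross (r • a) b = r * cross a b := by
  simp only [cross, Prod.smul_fst, Prod.smul_snd, smul_eq_mul]; ring

lemma cross_add_left (a b c : Plane) : cross (a + b) c = cross a c + cross b c := by
  simp only [cross, Prod.fst_add, Prod.snd_add]; ring

lemma cross_eq_zero_of_span_eq {a b : Plane}
    (h : Submodule.span ℝ {b} = Submodule.span ℝ {a}) : cross a b = 0 := by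
  have hb : b ∈ Submodule.span ℝ {a} := h ▸ Submodule.mem_span_singleton_self b
  obtain ⟨t, rfl⟩ := Submodule.mem_span_singleton.mp hb
  rw [cross_smul_right, cross_self, mul_zero]

/-- Supplies the scaling of three lattice directions that makes them sum to zero; its coefficients
are then integers. -/
lemma cross_relation (a b c : Plane) :
    cross b c • a + cross c a • b + cross a b • c = 0 := by
  apply Prod.ext <;> simp [cross] <;> ring

lemma isLatticePoint_edgeVec (hP : ∀ s, ∀ v ∈ (P s).vertexSet, IsLatticePoint v) (s : Bool)
    (i : Fin ((P s).m + 3)) : IsLatticePoint ((P s).edgeVec i) :=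
  IsLatticePoint.sub (hP s _ ⟨_, rfl⟩) (hP s _ ⟨_, rfl⟩)

/-- Every edge of a pair of lattice polygons with at most three tangent directions is parallel to
one of three pairwise independent integer vectors. -/
lemma exists_three_directions (hP : ∀ s, ∀ v ∈ (P s).vertexSet, IsLatticePoint v)
    (hdir : ((P false).directions ∪ (P true).directions).encard ≤ 3) :
    ∃ a b c : Plane, IsLatticePoint a ∧ IsLatticePoint b ∧ IsLatticePoint c ∧
      cross a b ≠ 0 ∧ cross b c ≠ 0 ∧ cross c a ≠ 0 ∧
      ∀ s i, cross a ((P s).edgeVec i) = 0 ∨ cross b ((P s).edgeVec i) = 0 ∨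
        cross c ((P s).edgeVec i) = 0 := by
  have hab := (P false).cross_edgeVec_succ 0
  have hal := isLatticePoint_edgeVec hP false 0
  have hbl := isLatticePoint_edgeVec hP false (0 + 1)
  set D := (P false).directions ∪ (P true).directions
  have hD : ∀ s i, Submodule.span ℝ {(P s).edgeVec i} ∈ D := by
    intro s i
    rw [← EmbeddedPolygon.edgeDirection_eq]
    cases s
    exacts [Or.inl ⟨i, rfl⟩, Or.inr ⟨i, rfl⟩]
  have haD := hD false 0
  have hbD := hD false (0 + 1)
  set a := (P false).edgeVec 0
  set b := (P false).edgeVec (0 + 1)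
  by_cases h : ∀ s i, cross a ((P s).edgeVec i) = 0 ∨ cross b ((P s).edgeVec i) = 0
  -- With only two directions present, `a + b` serves as a dummy third one.
  · refine ⟨a, b, a + b, hal, hbl, hal.add hbl, hab, ?_, ?_, fun s i => ?_⟩
    · rw [cross_add_right, cross_self, add_zero, cross_swap]; exact neg_ne_zero.mpr hab
    · rw [cross_add_left, cross_self, zero_add, cross_swap]; exact neg_ne_zero.mpr hab
    · rcases h s i with h | h
      exacts [Or.inl h, Or.inr (Or.inl h)]
  · push Not at h
    obtain ⟨s₀, i₀, h1, h2⟩ := h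
    have hcl := isLatticePoint_edgeVec hP s₀ i₀
    have hcD := hD s₀ i₀
    set c := (P s₀).edgeVec i₀
    refine ⟨a, b, c, hal, hbl, hcl, hab, h2, ?_, fun s i => ?_⟩
    · rw [cross_swap]; exact neg_ne_zero.mpr h1
    · have hsub : ({Submodule.span ℝ {a}, Submodule.span ℝ {b}, Submodule.span ℝ {c}} :
          Set (Submodule ℝ Plane)) ⊆ D := by
        rintro x (rfl | rfl | rfl)
        exacts [haD, hbD, hcD]
      have hcard : ({Submodule.span ℝ {a}, Submodule.span ℝ {b}, Submodule.span ℝ {c}} :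
          Set (Submodule ℝ Plane)).encard = 3 := by
        refine encard_eq_three.mpr ⟨_, _, _, ?_, ?_, ?_, rfl⟩
        · exact fun e => hab (cross_eq_zero_of_span_eq e.symm)
        · exact fun e => h1 (cross_eq_zero_of_span_eq e.symm)
        · exact fun e => h2 (cross_eq_zero_of_span_eq e.symm)
      have hDfin : D.Finite := finite_of_encard_le_coe (k := 3) hdir
      have heq := hDfin.eq_of_subset_of_encard_le' hsub (hdir.trans hcard.ge)
      have hmem := hD s i
      rw [← heq] at hmem
      rcases hmem with e | e | e
      · exact Or.inl (cross_eq_zero_of_span_eq e)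
      · exact Or.inr (Or.inl (cross_eq_zero_of_span_eq e))
      · exact Or.inr (Or.inr (cross_eq_zero_of_span_eq e))

/-- Three integer vectors with sum zero, pairwise independent, such that every edge is parallel to
one of them. -/
structure IsDirectionFrame (P : Bool → EmbeddedPolygon) (u : Fin 3 → Plane) : Prop where
  isLatticePoint : ∀ k, IsLatticePoint (u k)
  sum_eq_zero : ∑ k, u k = 0
  cross_ne_zero : ∀ k l, k ≠ l → cross (u k) (u l) ≠ 0
  exists_parallel : ∀ s i, ∃ k, cross (u k) ((P s).edgeVec i) = 0

lemma exists_isDirectionFrame (hP : ∀ s, ∀ v ∈ (P s).vertexSet, IsLatticePoint v)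
    (hdir : ((P false).directions ∪ (P true).directions).encard ≤ 3) :
    ∃ u, IsDirectionFrame P u := by
  obtain ⟨a, b, c, ha, hb, hc, hab, hbc, hca, hpar⟩ := exists_three_directions hP hdir
  have hba : cross b a ≠ 0 := by rw [cross_swap]; exact neg_ne_zero.mpr hab
  have hcb : cross c b ≠ 0 := by rw [cross_swap]; exact neg_ne_zero.mpr hbc
  have hac : cross a c ≠ 0 := by rw [cross_swap]; exact neg_ne_zero.mpr hca
  refine ⟨![cross b c • a, cross c a • b, cross a b • c], ⟨?_, ?_, ?_, ?_⟩⟩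
  · intro k
    fin_cases k
    exacts [hb.cross_smul hc ha, hc.cross_smul ha hb, ha.cross_smul hb hc]
  · rw [Fin.sum_univ_three]; exact cross_relation a b c
  · intro k l hkl
    fin_cases k <;> fin_cases l <;>
      simp [cross_smul_left, cross_smul_right, hab, hbc, hca, hba, hcb, hac] at hkl ⊢
  · intro s i
    rcases hpar s i with h | h | h
    · exact ⟨0, by simp [cross_smul_left, h]⟩
    · exact ⟨1, by simp [cross_smul_left, h]⟩
    · exact ⟨2, by simp [cross_smul_left, h]⟩

/-! ### Coordinate residues modulo integers along orbits. -/

/-- The real numbers congruent to an element of `S` modulo integers. -/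
def integerShifts (S : Finset ℝ) : Set ℝ := {r | ∃ c ∈ S, ∃ n : ℤ, r = n + c}

lemma integerShifts_mono {S T : Finset ℝ} (h : S ⊆ T) : integerShifts S ⊆ integerShifts T := by
  rintro r ⟨c, hc, n, rfl⟩
  exact ⟨c, h hc, n, rfl⟩

lemma intCast_mem_integerShifts {S : Finset ℝ} (h0 : 0 ∈ S) (n : ℤ) :
    (n : ℝ) ∈ integerShifts S := ⟨0, h0, n, by simp⟩

lemma neg_sub_intCast_mem_integerShifts {S : Finset ℝ} (hneg : ∀ c ∈ S, -c ∈ S) {r : ℝ}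
    (hr : r ∈ integerShifts S) (n : ℤ) : -r - n ∈ integerShifts S := by
  obtain ⟨c, hc, m, rfl⟩ := hr
  exact ⟨-c, hneg c hc, -m - n, by push_cast; ring⟩

namespace IsDirectionFrame

variable {u : Fin 3 → Plane}

lemma ne_zero (hu : IsDirectionFrame P u) (k : Fin 3) : u k ≠ 0 := by
  intro h
  have hk : k ≠ k + 1 := by fin_cases k <;> decide
  refine hu.cross_ne_zero k (k + 1) hk ?_
  simp [h, cross]

lemma cross_add_cross_add_cross (hu : IsDirectionFrame P u) {k l m : Fin 3} (hkl : k ≠ l)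
    (hkm : k ≠ m) (hlm : l ≠ m) (x : Plane) :
    cross (u k) x + cross (u l) x + cross (u m) x = 0 := by
  have huniv : (Finset.univ : Finset (Fin 3)) = {k, l, m} := by
    revert k l m; decide
  have h := hu.sum_eq_zero
  rw [huniv, Finset.sum_insert (by simp [hkl, hkm]), Finset.sum_pair hlm, ← add_assoc] at h
  rw [← cross_add_left, ← cross_add_left, h]
  simp [cross]

/-- The coordinates sum to zero, so when one is an integer the other two have opposite residues.
This is where exactly three directions matter. -/
lemma cross_mem_integerShifts (hu : IsDirectionFrame P u) {S : Finset ℝ} (h0 : 0 ∈ S)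
    (hneg : ∀ c ∈ S, -c ∈ S) {k l : Fin 3} (hkl : k ≠ l) {x : Plane}
    (hk : ∃ n : ℤ, cross (u k) x = n) (hl : cross (u l) x ∈ integerShifts S) (m : Fin 3) :
    cross (u m) x ∈ integerShifts S := by
  obtain ⟨n, hn⟩ := hk
  by_cases hkm : k = m
  · rw [← hkm, hn]; exact intCast_mem_integerShifts h0 n
  by_cases hlm : l = m
  · rwa [← hlm]
  have h := hu.cross_add_cross_add_cross hkl hkm hlm x
  have h1 : cross (u m) x = -cross (u l) x - n := by linarith
  rw [h1]
  exact neg_sub_intCast_mem_integerShifts hneg hl n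

lemma exists_cross_eq_intCast (hu : IsDirectionFrame P u)
    (hP : ∀ s, ∀ v ∈ (P s).vertexSet, IsLatticePoint v) {s : Bool} {x : Plane}
    {i : Fin ((P s).m + 3)} (hx : x ∈ (P s).openEdge i) {k : Fin 3}
    (hk : cross (u k) ((P s).edgeVec i) = 0) : ∃ n : ℤ, cross (u k) x = n := by
  obtain ⟨r, -, -, rfl⟩ := (P s).mem_openEdge.mp hx
  rw [cross_add_right, cross_smul_right, hk, mul_zero, add_zero]
  exact (hu.isLatticePoint k).exists_cross_eq (hP s _ ⟨i, rfl⟩)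

lemma exists_residue (hu : IsDirectionFrame P u)
    (hP : ∀ s, ∀ v ∈ (P s).vertexSet, IsLatticePoint v) {s : Bool} {x : Plane}
    {i : Fin ((P s).m + 3)} (hx : x ∈ (P s).openEdge i) :
    ∃ t : ℝ, |t| ≤ 1 ∧ ∀ l, cross (u l) x ∈ integerShifts {0, t, -t} := by
  obtain ⟨k, hk⟩ := hu.exists_parallel s i
  -- Coordinate `k` is an integer on this edge; `k + 1` is just another index.
  refine ⟨Int.fract (cross (u (k + 1)) x), ?_, ?_⟩
  · rw [abs_of_nonneg (Int.fract_nonneg _)]; exact (Int.fract_lt_one _).le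
  · refine hu.cross_mem_integerShifts (k := k) (l := k + 1) (by simp) ?_ ?_
      (hu.exists_cross_eq_intCast hP hx hk) ?_
    · intro c hc
      simp only [Finset.mem_insert, Finset.mem_singleton] at hc ⊢
      rcases hc with rfl | rfl | rfl <;> simp
    · clear hk
      revert k
      decide
    · exact ⟨_, by simp, ⌊cross (u (k + 1)) x⌋, (Int.floor_add_fract _).symm⟩

/-- The residues of the coordinates along an orbit do not change. -/
lemma step_mem_integerShifts (hu : IsDirectionFrame P u)
    (hP : ∀ s, ∀ v ∈ (P s).vertexSet, IsLatticePoint v) {S : Finset ℝ} (h0 : 0 ∈ S)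
    (hneg : ∀ c ∈ S, -c ∈ S) {a b : PhasePoint} (ha : a ∈ phaseSpace P) (h : Step P a b)
    (hx : ∀ l, cross (u l) a.fst ∈ integerShifts S) (l : Fin 3) :
    cross (u l) b.snd ∈ integerShifts S := by
  obtain ⟨hmax, -, -, hrefl⟩ := step_iff.mp h
  obtain ⟨s, x, y⟩ := a
  obtain ⟨j, hy⟩ := exists_snd_mem_openEdge hmax
  obtain ⟨i, hz⟩ := (P s).exists_mem_openEdge hrefl.1 (h.snd_notMem_vertexSet ha)
  obtain ⟨k, hk⟩ := hu.exists_parallel _ j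
  obtain ⟨m, hm⟩ := hu.exists_parallel _ i
  have hmk : m ≠ k := by
    rintro rfl
    exact hrefl.cross_ne_zero rfl hz hy (cross_eq_zero_of_cross_eq_zero (hu.ne_zero m) hm hk)
  -- Coordinate `m` of `z` is an integer because of its edge, and coordinate `k` is inherited from
  -- `x`.
  refine hu.cross_mem_integerShifts h0 hneg hmk (hu.exists_cross_eq_intCast hP hz hm) ?_ l
  obtain ⟨-, ⟨t, ht⟩, -⟩ := (isReflection_iff rfl hy).mp hrefl
  rw [ht, cross_add_right, cross_smul_right, hk, mul_zero, add_zero]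
  exact hx k

lemma ext_of_cross_eq (hu : IsDirectionFrame P u) {x y : Plane}
    (h0 : cross (u 0) x = cross (u 0) y) (h1 : cross (u 1) x = cross (u 1) y) : x = y := by
  have h2 : cross (u 0) (x - y) = 0 := by rw [cross_sub_right, h0, sub_self]
  obtain ⟨r, hr⟩ := exists_eq_smul_of_cross_eq_zero (hu.ne_zero 0) h2
  have h3 : cross (u 1) (x - y) = 0 := by rw [cross_sub_right, h1, sub_self]
  rw [hr, cross_smul_right] at h3
  have hr0 : r = 0 := (mul_eq_zero.mp h3).resolve_right (hu.cross_ne_zero 1 0 (by decide))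
  rw [hr0, zero_smul, sub_eq_zero] at hr
  exact hr

end IsDirectionFrame

/-! ### Counting orbit points and bounding the period. -/

lemma exists_cross_bound (P : Bool → EmbeddedPolygon) (u : Fin 3 → Plane) :
    ∃ M : ℕ, ∀ s, ∀ x ∈ (P s).curve, ∀ k, |cross (u k) x| ≤ M := by
  have h : ∀ (s : Bool) (k : Fin 3), ∃ M : ℕ, ∀ x ∈ (P s).curve, |cross (u k) x| ≤ M := by
    intro s k
    obtain ⟨C, hC⟩ := (P s).isCompact_curve.exists_bound_of_continuousOn
      (continuous_cross (u k)).continuousOn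
    obtain ⟨M, hM⟩ := exists_nat_ge C
    exact ⟨M, fun x hx => (hC x hx).trans hM⟩
  choose M hM using h
  refine ⟨∑ s, ∑ k, M s k, fun s x hx k => (hM s k x hx).trans ?_⟩
  have h1 : M s k ≤ ∑ k, M s k :=
    Finset.single_le_sum (f := fun k => M s k) (fun _ _ => Nat.zero_le _) (Finset.mem_univ k)
  have h2 : ∑ k, M s k ≤ ∑ s, ∑ k, M s k :=
    Finset.single_le_sum (f := fun s => ∑ k, M s k) (fun _ _ => Nat.zero_le _) (Finset.mem_univ s)
  exact_mod_cast h1.trans h2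

open Classical in
/-- The elements `n + c` with `c` in `S` and `n` an integer at most `M + 1` in absolute value. -/
noncomputable def boundedShifts (S : Finset ℝ) (M : ℕ) : Finset ℝ :=
  (Finset.Icc (-(M + 1) : ℤ) (M + 1) ×ˢ S).image fun x => x.1 + x.2

lemma mem_boundedShifts {S : Finset ℝ} (hS : ∀ c ∈ S, |c| ≤ 1) {M : ℕ} {r : ℝ} (hr : |r| ≤ M)
    (h : r ∈ integerShifts S) : r ∈ boundedShifts S M := by
  obtain ⟨c, hc, n, rfl⟩ := h
  refine Finset.mem_image.mpr ⟨(n, c), Finset.mem_product.mpr ⟨Finset.mem_Icc.mpr ?_, hc⟩, rfl⟩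
  obtain ⟨h1, h2⟩ := abs_le.mp hr
  obtain ⟨h3, h4⟩ := abs_le.mp (hS c hc)
  constructor
  · have : (-(M + 1) : ℝ) ≤ n := by linarith
    exact_mod_cast this
  · have : (n : ℝ) ≤ M + 1 := by linarith
    exact_mod_cast this

lemma card_boundedShifts_le (S : Finset ℝ) (M : ℕ) :
    (boundedShifts S M).card ≤ (2 * M + 3) * S.card := by
  refine Finset.card_image_le.trans ?_
  rw [Finset.card_product, Int.card_Icc]
  refine Nat.mul_le_mul_right _ ?_
  omega

lemma IsOrbit.shift {o : ℤ → PhasePoint} (h : IsOrbit P o) (a : ℤ) :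
    IsOrbit P fun k => o (k + a) := by
  refine ⟨fun k => h.1 _, fun k => ?_⟩
  have := h.2 (k + a)
  rwa [add_right_comm] at this

lemma IsOrbit.periodic_of_eq {o : ℤ → PhasePoint} (h : IsOrbit P o) {a b : ℤ} (hab : o a = o b)
    (k : ℤ) : o (k + (b - a)) = o k := by
  have h1 := congrFun (IsOrbit.ext (h.shift a) (h.shift b) (by simpa using hab)) (k - a)
  simp only [sub_add_cancel] at h1
  rw [h1]
  congr 1
  ring

/-- The periods of the orbits of a pair of lattice polygons with at most three tangent directions
are uniformly bounded. -/
theorem exists_period_bound (hP : ∀ s, ∀ v ∈ (P s).vertexSet, IsLatticePoint v)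
    (hdir : ((P false).directions ∪ (P true).directions).encard ≤ 3) :
    ∃ B : ℕ, ∀ o : ℤ → PhasePoint, IsOrbit P o →
      ∃ n : ℕ, 0 < n ∧ n ≤ B ∧ ∀ k : ℤ, o (k + n) = o k := by
  classical
  obtain ⟨u, hu⟩ := exists_isDirectionFrame hP hdir
  obtain ⟨M, hM⟩ := exists_cross_bound P u
  -- `K` bounds the values of one coordinate: `2 * M + 3` integer parts and at most 6 residues. `M`,
  -- hence the bound, does not depend on the orbit.
  set K := (2 * M + 3) * 6 with hK
  refine ⟨2 * (K * (K * (K * K))), fun o ho => ?_⟩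
  have hstep : ∀ k, Step P (o k) (o (k + 1)) := ho.2
  obtain ⟨i, hi⟩ := (P (o 0).sign).exists_mem_openEdge (ho.1 0).1.1.1
    (fst_notMem_vertexSet (ho.1 0))
  obtain ⟨j, hj⟩ := exists_snd_mem_openEdge (ho.1 0).1
  obtain ⟨t, ht1, ht⟩ := hu.exists_residue hP hi
  obtain ⟨t', ht1', ht'⟩ := hu.exists_residue hP hj
  -- The two tables alternate between the entries, so both components need the residues of both
  -- initial points.
  set S : Finset ℝ := {0, t, -t} ∪ {0, t', -t'} with hS
  have h0 : (0 : ℝ) ∈ S := by simp [hS]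
  have hmemS : ∀ c, c ∈ S ↔ c = 0 ∨ c = t ∨ c = -t ∨ c = t' ∨ c = -t' := by
    intro c
    simp only [hS, Finset.mem_union, Finset.mem_insert, Finset.mem_singleton]
    tauto
  have hneg : ∀ c ∈ S, -c ∈ S := by
    intro c hc
    rw [hmemS] at hc ⊢
    rcases hc with rfl | rfl | rfl | rfl | rfl <;> simp
  have habs : ∀ c ∈ S, |c| ≤ 1 := by
    intro c hc
    rw [hmemS] at hc
    rcases hc with rfl | rfl | rfl | rfl | rfl <;> simp [ht1, ht1']
  have hcardS : S.card ≤ 6 :=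
    (Finset.card_union_le _ _).trans (add_le_add Finset.card_le_three Finset.card_le_three)
  have hinv : ∀ n : ℕ, (∀ l, cross (u l) (o n).fst ∈ integerShifts S) ∧
      ∀ l, cross (u l) (o n).snd ∈ integerShifts S := by
    intro n
    induction n with
    | zero => exact ⟨fun l => integerShifts_mono Finset.subset_union_left (ht l),
        fun l => integerShifts_mono Finset.subset_union_right (ht' l)⟩
    | succ n ih =>
      have hs := hstep n
      push_cast
      refine ⟨?_, fun l => hu.step_mem_integerShifts hP h0 hneg (ho.1 n) hs ih.1 l⟩
      rw [(step_iff.mp hs).2.2.1]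
      exact ih.2
  set V := boundedShifts S M with hV
  have hVcard : V.card ≤ K := (card_boundedShifts_le S M).trans (Nat.mul_le_mul_left _ hcardS)
  -- Two of the three coordinates already determine a point of the plane.
  set F : PhasePoint → Bool × ℝ × ℝ × ℝ × ℝ := fun a =>
    (a.sign, cross (u 0) a.fst, cross (u 1) a.fst, cross (u 0) a.snd, cross (u 1) a.snd) with hF
  have hFinj : ∀ a b, F a = F b → a = b := by
    intro a b h
    simp only [hF, Prod.mk.injEq] at h
    obtain ⟨h1, h2, h3, h4, h5⟩ := h
    exact PhasePoint.ext h1 (hu.ext_of_cross_eq h2 h3) (hu.ext_of_cross_eq h4 h5)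
  set W := (Finset.univ : Finset Bool) ×ˢ V ×ˢ V ×ˢ V ×ˢ V with hW
  have hWcard : W.card ≤ 2 * (K * (K * (K * K))) := by
    simp only [hW, Finset.card_product, Finset.card_univ, Fintype.card_bool]
    gcongr
  have hmaps : ∀ n ∈ Finset.range (2 * (K * (K * (K * K))) + 1), F (o n) ∈ W := by
    intro n _
    obtain ⟨h1, h2⟩ := hinv n
    have hb1 := hM _ _ (ho.1 n).1.1.1
    have hb2 := hM _ _ (ho.1 n).1.1.2
    simp only [hW, hF, Finset.mem_product]
    exact ⟨Finset.mem_univ _, mem_boundedShifts habs (hb1 0) (h1 0),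
      mem_boundedShifts habs (hb1 1) (h1 1), mem_boundedShifts habs (hb2 0) (h2 0),
      mem_boundedShifts habs (hb2 1) (h2 1)⟩
  obtain ⟨a, ha, b, hb, hne, heq⟩ := Finset.exists_ne_map_eq_of_card_lt_of_maps_to
    (by rw [Finset.card_range]; omega) hmaps
  have hab := hFinj _ _ heq
  rw [Finset.mem_range] at ha hb
  rcases lt_or_gt_of_ne hne with h | h
  · refine ⟨b - a, by omega, by omega, fun k => ?_⟩
    rw [Nat.cast_sub h.le]
    exact ho.periodic_of_eq hab k
  · refine ⟨a - b, by omega, by omega, fun k => ?_⟩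
    rw [Nat.cast_sub h.le]
    exact ho.periodic_of_eq hab.symm k

end SymplecticBilliard

theorem corollary3p2 (P : Bool → SymplecticBilliard.EmbeddedPolygon)
    (hlattice : ∀ (s : Bool), ∀ v ∈ (P s).vertexSet, ∃ a b : ℤ, v = ((a : ℝ), (b : ℝ)))
    (hdirections : ((P false).directions ∪ (P true).directions).encard ≤ 3) :
    (∀ p ∈ SymplecticBilliard.phaseSpace P,
      ∃! o : ℤ → SymplecticBilliard.PhasePoint, SymplecticBilliard.IsOrbit P o ∧ o 0 = p) ∧
    ∃ B : ℕ, ∀ o : ℤ → SymplecticBilliard.PhasePoint, SymplecticBilliard.IsOrbit P o →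
      ∃ n : ℕ, 0 < n ∧ n ≤ B ∧ ∀ k : ℤ, o (k + n) = o k := by
  exact ⟨fun _ hp => SymplecticBilliard.existsUnique_orbit hp,
    SymplecticBilliard.exists_period_bound hlattice hdirections⟩
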